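/- Let $n,d\ge 0$ be integers, let $M=\mathrm{Mat}_{n\times d}(\mathbb C)$ be regarded as a real manifold, and let $\lambda\in\mathbb R$, $\lambda\neq0$. For $m\in\mathbb N$ let $\mathfrak k_m=u(m)$, let $\mathfrak b_m$ be the Lie algebra of upper triangular $m\times m$ complex matrices with real diagonal, and let $B_m$ be the group of upper triangular $m\times m$ complex matrices with positive diagonal. Then $\mathfrak{gl}(m,\mathbb C)=\mathfrak k_m\oplus\mathfrak b_m$; let $X\mapsto X_{\mathfrak k_m}$ be the projection onto $\mathfrak k_m$ along $\mathfrak b_m$, and let $\langle X,Y\rangle=\mathrm{Im}\,\mathrm{tr}(XY)$, which pairs $\mathfrak k_m$ with $\mathfrak b_m$ nondegenerately and makes $B_m$ the dual group of $U(m)$. Give $U(m)$ the bracket $$\{f,h\}(k)=\mathrm{Im}\,\mathrm{tr}\bigl(D_kf\;k\,(D'_kh)\,k^{-1}\bigr),$$ where $D_kf,D'_kf\in\mathfrak b_m$ are defined by $\frac{d}{dt}\big|_{t=0}f(e^{t\xi}k)=\langle\xi,D_kf\rangle$ and $\frac{d}{dt}\big|_{t=0}f(ke^{t\xi})=\langle\xi,D'_kf\rangle$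 for all $\xi\in\mathfrak k_m$. Writing covectors on $M$ as $w\mapsto\mathrm{Im}\,\mathrm{tr}(\xi^\dagger w)$ with $\xi\in M$, give $M$ the bracket $\{F,H\}(v)=P(v)(dF,dH)$ of the bivector $$P(v)(\xi,\eta)=\mathrm{Im}\,\mathrm{tr}\bigl(v\xi^\dagger(v\eta^\dagger)_{\mathfrak k_n}+\xi^\dagger v(\eta^\dagger v)_{\mathfrak k_d}-\xi^\dagger v\eta^\dagger v-\lambda\,\xi^\dagger\eta\bigr).$$ Let $U(n)$ and $U(d)$ act on $M$ by $k\cdot v=kv$ and $k\cdot v=vk^{-1}$ respectively. For every $m$ the map $b\mapsto bb^\dagger$ is a bijection from $B_m$ onto the positive definite hermitian $m\times m$ matrices. Let $\Phi^{(n)}_\lambda(v)=\lambda+vv^\dagger$ and $\Phi^{(d)}_\lambda(v)=(\lambda+v^\dagger v)^{-1}$. These matrices are positive definite for all $v\in M$ if $\lambda>0$; in general let $M^{(n)}_\lambda$ and $M^{(d)}_\lambda$ be the sets of those $v\in M$ for which $\Phi^{(n)}_\lambda(v)$, respectively $\lambda+v^\dagger v$ together with its inverse $\Phi^{(d)}_\lambda(v)$,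 is positive definite; they are open. Let $J^{(n)}:M^{(n)}_\lambda\to B_n$ and $J^{(d)}:M^{(d)}_\lambda\to B_d$ be given by $J^{(n)}J^{(n)\dagger}=\Phi^{(n)}_\lambda$ and $J^{(d)}J^{(d)\dagger}=\Phi^{(d)}_\lambda$. Then $J^{(n)}$ and $J^{(d)}$ are momentum maps for the Poisson actions of $U(n)$ and of $U(d)$ on $M$. That is: with the above brackets $M$ is a Poisson space, $U(n)$ and $U(d)$ are Poisson Lie groups and their actions on $M$ are Poisson actions; and for $(m,J)=(n,J^{(n)})$ and $(m,J)=(d,J^{(d)})$ the map $J$ is smooth and $$P\bigl(\,\cdot\,,J^*\tilde X\bigr)=X_M\qquad\text{on } M^{(m)}_\lambda\text{ for all }X\in\mathfrak k_m,$$ where $X_M(v)=\frac{d}{dt}\big|_{t=0}e^{tX}\cdot v$ is the infinitesimal action of $U(m)$, and $\tilde X$ is the right-invariant one-form on $B_m$ whose value at $b$ on the velocity $\xi b$ of $e^{t\xi}b$ is $\langle X,\xi\rangle$ $(\xi\in\mathfrak b_m)$. -/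

import Mathlib

open scoped ContDiff Matrix ComplexOrder

attribute [local instance] Matrix.normedAddCommGroup Matrix.normedSpace

noncomputable section

/-! ### Poisson brackets, Poisson Lie groups, Poisson actions -/

/-- `br` is a Poisson bracket on the algebra `A` of real-valued functions on `V`. -/
structure IsPoissonBracket {V : Type} (A : Subalgebra ℝ (V → ℝ))
    (br : (V → ℝ) → (V → ℝ) → (V → ℝ)) : Prop where
  mem : ∀ f ∈ A, ∀ g ∈ A, br f g ∈ A
  add_left : ∀ f ∈ A, ∀ g ∈ A, ∀ h ∈ A, br (f + g) h = br f h + br g h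
  smul_left : ∀ (c : ℝ), ∀ f ∈ A, ∀ h ∈ A, br (c • f) h = c • br f h
  antisymm : ∀ f ∈ A, ∀ g ∈ A, br f g = -br g f
  leibniz : ∀ f ∈ A, ∀ g ∈ A, ∀ h ∈ A, br f (g * h) = br f g * h + g * br f h
  jacobi : ∀ f ∈ A, ∀ g ∈ A, ∀ h ∈ A, br f (br g h) + br g (br h f) + br h (br f g) = 0

/-- `br` makes the group `K` (with `A` as its algebra of smooth functions) a Poisson Lie group:
it is a Poisson bracket for which the multiplication `K × K → K` is a Poisson map. -/
structure IsPoissonLieBracket {K : Type} [Group K] (A : Subalgebra ℝ (K → ℝ))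
    (br : (K → ℝ) → (K → ℝ) → (K → ℝ)) : Prop where
  poisson : IsPoissonBracket A br
  left_mem : ∀ f ∈ A, ∀ g₁ : K, (fun g => f (g₁ * g)) ∈ A
  right_mem : ∀ f ∈ A, ∀ g₂ : K, (fun g => f (g * g₂)) ∈ A
  mul_poisson : ∀ f ∈ A, ∀ h ∈ A, ∀ g₁ g₂ : K,
    br (fun g => f (g * g₂)) (fun g => h (g * g₂)) g₁
      + br (fun g => f (g₁ * g)) (fun g => h (g₁ * g)) g₂ = br f h (g₁ * g₂)

/-- `act` is an action of the group `K` on `V` for which the map `K × V → V` is Poisson. -/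
structure IsPoissonAction {K V : Type} [Group K]
    (AK : Subalgebra ℝ (K → ℝ)) (brK : (K → ℝ) → (K → ℝ) → (K → ℝ))
    (AV : Subalgebra ℝ (V → ℝ)) (brV : (V → ℝ) → (V → ℝ) → (V → ℝ))
    (act : K → V → V) : Prop where
  act_one : ∀ v, act 1 v = v
  act_mul : ∀ g h v, act (g * h) v = act g (act h v)
  orbit_mem : ∀ f ∈ AV, ∀ v, (fun g => f (act g v)) ∈ AK
  translate_mem : ∀ f ∈ AV, ∀ g, (fun v => f (act g v)) ∈ AV
  act_poisson : ∀ f ∈ AV, ∀ h ∈ AV, ∀ g v,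
    brV f h (act g v) =
      brK (fun g' => f (act g' v)) (fun g' => h (act g' v)) g
        + brV (fun v' => f (act g v')) (fun v' => h (act g v')) v

/-! ### The Lie algebras `u(m)` and `b(m)` and the group `B(m)` -/

/-- The Lie algebra `u(m)` of skew-hermitian matrices. -/
def uLie (m : ℕ) : Submodule ℝ (Matrix (Fin m) (Fin m) ℂ) where
  carrier := {X | Xᴴ = -X}
  add_mem' := by
    intro X Y hX hY
    simp only [Set.mem_ofPred_eq] at *
    rw [Matrix.conjTranspose_add, hX, hY, neg_add]
  zero_mem' := by simp
  smul_mem' := by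
    intro c X hX
    simp only [Set.mem_ofPred_eq] at *
    rw [Matrix.conjTranspose_smul, hX, star_trivial, smul_neg]

/-- The Lie algebra of upper triangular matrices with real entries on the diagonal. -/
def bLie (m : ℕ) : Submodule ℝ (Matrix (Fin m) (Fin m) ℂ) where
  carrier := {X | (∀ i j, j < i → X i j = 0) ∧ ∀ i, (X i i).im = 0}
  add_mem' := by
    rintro X Y ⟨hX, hX'⟩ ⟨hY, hY'⟩
    exact ⟨fun i j h => by simp [hX i j h, hY i j h], fun i => by simp [hX' i, hY' i]⟩
  zero_mem' := by simp
  smul_mem' := by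
    rintro c X ⟨hX, hX'⟩
    exact ⟨fun i j h => by simp [hX i j h], fun i => by simp [hX' i]⟩

/-- The projection of `gl(m, ℂ) = u(m) ⊕ b(m)` onto `u(m)`. -/
def kProj {m : ℕ} (X : Matrix (Fin m) (Fin m) ℂ) : Matrix (Fin m) (Fin m) ℂ :=
  Matrix.of fun i j =>
    if j < i then X i j else if i < j then -star (X j i) else Complex.I * ((X i i).im : ℂ)

/-- `kProj X` is the unique element of `u(m)` whose difference to `X` lies in `b(m)`. -/
theorem kProj_spec {m : ℕ} (X : Matrix (Fin m) (Fin m) ℂ) :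
    kProj X ∈ uLie m ∧ X - kProj X ∈ bLie m := by
  refine ⟨?_, ?_, ?_⟩
  · change (kProj X)ᴴ = -kProj X
    ext i j
    rcases lt_trichotomy i j with h | h | h
    · simp [kProj, h, h.not_gt]
    · subst h
      simp [kProj]
    · simp [kProj, h, h.not_gt]
  · intro i j h
    simp [kProj, h]
  · intro i
    simp [kProj]

/-- The group `B(m)` of upper triangular matrices with real, positive diagonal entries. -/
def BGroup (m : ℕ) : Subgroup (GL (Fin m) ℂ) where
  carrier := {b | (∀ i j, j < i → b.val i j = 0) ∧ ∀ i, 0 < b.val i i}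
  one_mem' := by
    refine ⟨fun i j h => ?_, fun i => ?_⟩
    · simp [Matrix.one_apply_ne h.ne']
    · simp
  mul_mem' := by
    rintro a b ⟨ha, ha'⟩ ⟨hb, hb'⟩
    have hbt : ((a * b : GL (Fin m) ℂ).val).BlockTriangular id := by
      rw [Units.val_mul]
      exact Matrix.BlockTriangular.mul (fun i j h => ha i j h) (fun i j h => hb i j h)
    refine ⟨fun i j h => hbt h, fun i => ?_⟩
    rw [Units.val_mul, Matrix.mul_apply, Finset.sum_eq_single i]
    · exact mul_pos (ha' i) (hb' i)
    · intro j _ hj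
      rcases lt_or_gt_of_ne hj with h | h
      · rw [ha i j h, zero_mul]
      · rw [hb j i h, mul_zero]
    · simp
  inv_mem' := by
    rintro b ⟨hb, hb'⟩
    have hinv : Invertible b.val := b.isUnit.invertible
    have hbt : (b.val⁻¹).BlockTriangular id :=
      Matrix.blockTriangular_inv_of_blockTriangular (fun i j h => hb i j h)
    have hco : (b⁻¹).val = b.val⁻¹ := Matrix.coe_units_inv b
    refine ⟨fun i j h => by rw [hco]; exact hbt h, fun i => ?_⟩
    have h1 : (b.val * (b⁻¹).val) i i = 1 := by simp
    rw [Matrix.mul_apply, Finset.sum_eq_single i] at h1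
    · rw [eq_inv_of_mul_eq_one_right h1]
      exact inv_pos.mpr (hb' i)
    · intro j _ hj
      rcases lt_or_gt_of_ne hj with h | h
      · rw [hb i j h, zero_mul]
      · rw [hco, show b.val⁻¹ j i = 0 from hbt h, mul_zero]
    · simp

/-- The underlying matrix of an element of `B(m)`. -/
def bMat {m : ℕ} (b : BGroup m) : Matrix (Fin m) (Fin m) ℂ := b.1.val

/-- The identification of positive definite hermitian matrices with elements of `B(m)`: `bOf Λ` is
the element `b` of `B(m)` with `b b† = Λ` (arbitrary if there is none). -/
def bOf {m : ℕ} (Λ : Matrix (Fin m) (Fin m) ℂ) : BGroup m :=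
  Classical.epsilon fun b : BGroup m => bMat b * (bMat b)ᴴ = Λ

/-- The pairing `⟨X, Y⟩ = Im tr (X Y)` on `gl(m, ℂ)`, which makes `b(m)` the dual of `u(m)`. -/
def imTr {m : ℕ} (X Y : Matrix (Fin m) (Fin m) ℂ) : ℝ := (X * Y).trace.im

/-! ### The Poisson Lie group `U(m)` -/

/-- The one-parameter subgroups of `U(m)`: the exponential of an element of `u(m)`. -/
def expU {m : ℕ} (X : uLie m) : Matrix.unitaryGroup (Fin m) ℂ :=
  ⟨NormedSpace.exp X.1, by
    have hX : X.1ᴴ = -X.1 := X.2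
    rw [Matrix.mem_unitaryGroup_iff, Matrix.star_eq_conjTranspose, ← Matrix.exp_conjTranspose, hX,
      ← Matrix.exp_add_of_commute _ _ (Commute.refl X.1).neg_right, add_neg_cancel,
      NormedSpace.exp_zero]⟩

/-- Smooth real-valued functions on `U(m)`, a closed embedded submanifold of the space of
matrices: the restrictions of smooth functions of matrices. -/
def smoothU (m : ℕ) : Subalgebra ℝ (Matrix.unitaryGroup (Fin m) ℂ → ℝ) where
  carrier := {f | ∃ F : Matrix (Fin m) (Fin m) ℂ → ℝ, ContDiff ℝ ∞ F ∧ ∀ k, f k = F k.1}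
  mul_mem' := by
    rintro f g ⟨F, hF, hf⟩ ⟨G, hG, hg⟩
    exact ⟨fun x => F x * G x, hF.mul hG, fun k => by simp [hf, hg]⟩
  add_mem' := by
    rintro f g ⟨F, hF, hf⟩ ⟨G, hG, hg⟩
    exact ⟨fun x => F x + G x, hF.add hG, fun k => by simp [hf, hg]⟩
  algebraMap_mem' := fun r => ⟨fun _ => r, contDiff_const, fun _ => rfl⟩

/-- The left-derivative `D_k f`: the element of `b(m)` with
`d/dt f(exp(tξ) k) = Im tr (ξ D_k f)` at `t = 0` for all `ξ` in `u(m)`. -/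
def leftDeriv {m : ℕ} (f : Matrix.unitaryGroup (Fin m) ℂ → ℝ)
    (k : Matrix.unitaryGroup (Fin m) ℂ) : Matrix (Fin m) (Fin m) ℂ :=
  Classical.epsilon fun β => β ∈ bLie m ∧
    ∀ ξ : uLie m, deriv (fun t : ℝ => f (expU (t • ξ) * k)) 0 = imTr ξ.1 β

/-- The right-derivative `D'_k f`: the element of `b(m)` with
`d/dt f(k exp(tξ)) = Im tr (ξ D'_k f)` at `t = 0` for all `ξ` in `u(m)`. -/
def rightDeriv {m : ℕ} (f : Matrix.unitaryGroup (Fin m) ℂ → ℝ)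
    (k : Matrix.unitaryGroup (Fin m) ℂ) : Matrix (Fin m) (Fin m) ℂ :=
  Classical.epsilon fun β => β ∈ bLie m ∧
    ∀ ξ : uLie m, deriv (fun t : ℝ => f (k * expU (t • ξ))) 0 = imTr ξ.1 β

/-- The bracket `{f, h}(k) = Im tr (D_k f · k (D'_k h) k⁻¹)` on `U(m)`. -/
def bracketU (m : ℕ) (f h : Matrix.unitaryGroup (Fin m) ℂ → ℝ)
    (k : Matrix.unitaryGroup (Fin m) ℂ) : ℝ :=
  imTr (leftDeriv f k) (k.1 * rightDeriv h k * (k⁻¹).1)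

/-! ### The Poisson space of `n × d` matrices -/

/-- Smooth real-valued functions of `n × d` complex matrices. -/
def smoothM (n d : ℕ) : Subalgebra ℝ (Matrix (Fin n) (Fin d) ℂ → ℝ) where
  carrier := {f | ContDiff ℝ ∞ f}
  mul_mem' := by
    intro f g hf hg
    simp only [Set.mem_ofPred_eq] at *
    exact hf.mul hg
  add_mem' := by
    intro f g hf hg
    simp only [Set.mem_ofPred_eq] at *
    exact hf.add hg
  algebraMap_mem' := by
    intro r
    simp only [Set.mem_ofPred_eq]
    exact contDiff_const

/-- The matrix `ξ†` of a covector: `α w = Im tr (ξ† w)`, see `covMat_spec`. -/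
def covMat {n d : ℕ} (α : Matrix (Fin n) (Fin d) ℂ →L[ℝ] ℝ) : Matrix (Fin d) (Fin n) ℂ :=
  Matrix.of fun j i => ⟨α (Matrix.single i j Complex.I), α (Matrix.single i j 1)⟩

theorem covMat_spec {n d : ℕ} (α : Matrix (Fin n) (Fin d) ℂ →L[ℝ] ℝ)
    (w : Matrix (Fin n) (Fin d) ℂ) : α w = (covMat α * w).trace.im := by
  have hw : ∀ i j, α (Matrix.single i j (w i j)) = (covMat α j i * w i j).im := by
    intro i j
    have h : Matrix.single i j (w i j) = (w i j).re • Matrix.single i j (1 : ℂ)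
        + (w i j).im • Matrix.single i j Complex.I := by
      rw [Matrix.smul_single, Matrix.smul_single, ← Matrix.single_add]
      congr 1
      apply Complex.ext <;> simp
    rw [h, map_add, map_smul, map_smul]
    simp only [covMat, Matrix.of_apply, Complex.mul_im, smul_eq_mul]
    ring
  conv_lhs => rw [Matrix.matrix_eq_sum_single w]
  simp only [map_sum, hw]
  rw [Finset.sum_comm]
  simp [Matrix.trace, Matrix.mul_apply, Complex.im_sum]

/-- The bivector
`P(v)(ξ, η) = Im tr (vξ†(vη†)_u + ξ†v(η†v)_u - ξ†vη†v - λ ξ†η)`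
on the space of `n × d` matrices, as a form on covectors. -/
def poissonM {n d : ℕ} (lam : ℝ) (v : Matrix (Fin n) (Fin d) ℂ)
    (α β : Matrix (Fin n) (Fin d) ℂ →L[ℝ] ℝ) : ℝ :=
  let x := covMat α
  let y := covMat β
  (v * x * kProj (v * y)).trace.im + (x * v * kProj (y * v)).trace.im
    - (x * v * y * v).trace.im - lam * (x * yᴴ).trace.im

/-- The bracket of functions defined by the bivector `poissonM`. -/
def bracketM {n d : ℕ} (lam : ℝ) (f h : Matrix (Fin n) (Fin d) ℂ → ℝ)
    (v : Matrix (Fin n) (Fin d) ℂ) : ℝ :=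
  poissonM lam v (fderiv ℝ f v) (fderiv ℝ h v)

/-- The action `k · v = k v` of `U(n)`. -/
def actLeft {n d : ℕ} (k : Matrix.unitaryGroup (Fin n) ℂ) (v : Matrix (Fin n) (Fin d) ℂ) :
    Matrix (Fin n) (Fin d) ℂ := k.1 * v

/-- The action `k · v = v k⁻¹` of `U(d)`. -/
def actRight {n d : ℕ} (k : Matrix.unitaryGroup (Fin d) ℂ) (v : Matrix (Fin n) (Fin d) ℂ) :
    Matrix (Fin n) (Fin d) ℂ := v * (k⁻¹).1

/-! ### Momentum maps -/

/-- The right-invariant one-form on `B(m)` defined by `X`, at the point `b`: the tangent vector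
`δ` at `b` is the velocity of `exp(tξ) b` for `ξ = δ b⁻¹`, and the form takes the value
`⟨X, ξ⟩` on it. -/
def rightInvForm {m : ℕ} (X : Matrix (Fin m) (Fin m) ℂ) (b : BGroup m) :
    Matrix (Fin m) (Fin m) ℂ →L[ℝ] ℝ :=
  LinearMap.toContinuousLinearMap
    { toFun := fun δ => imTr X (δ * bMat b⁻¹)
      map_add' := fun δ ε => by simp [imTr, add_mul, mul_add]
      map_smul' := fun c δ => by simp [imTr] }

/-- The pull-back of the right-invariant one-form defined by `X` along `J`, at the point `v`. -/
def pullbackForm {m n d : ℕ} (J : Matrix (Fin n) (Fin d) ℂ → BGroup m)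
    (X : Matrix (Fin m) (Fin m) ℂ) (v : Matrix (Fin n) (Fin d) ℂ) :
    Matrix (Fin n) (Fin d) ℂ →L[ℝ] ℝ :=
  (rightInvForm X (J v)).comp (fderiv ℝ (fun w => bMat (J w)) v)

/-- The infinitesimal action `X_M(v)`, the velocity at `t = 0` of `exp(tX) · v`. -/
def infAct {m n d : ℕ}
    (act : Matrix.unitaryGroup (Fin m) ℂ → Matrix (Fin n) (Fin d) ℂ → Matrix (Fin n) (Fin d) ℂ)
    (X : uLie m) (v : Matrix (Fin n) (Fin d) ℂ) : Matrix (Fin n) (Fin d) ℂ :=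
  deriv (fun t : ℝ => act (expU (t • X)) v) 0

/-- The map `J`, defined on the open set `U` of the Poisson space of `n × d` matrices, with values
in the dual group `B(m)` of the Poisson Lie group `U(m)`, is a momentum map for the Poisson action
`act` of `U(m)`: for `X` in `u(m)` and `X̃` the right-invariant one-form on `B(m)` defined by `X`,
one has `P(·, J^* X̃) = X_M` on `U`. -/
structure IsMomentumMapOn {m n d : ℕ} (lam : ℝ)
    (act : Matrix.unitaryGroup (Fin m) ℂ → Matrix (Fin n) (Fin d) ℂ → Matrix (Fin n) (Fin d) ℂ)
    (U : Set (Matrix (Fin n) (Fin d) ℂ)) (J : Matrix (Fin n) (Fin d) ℂ → BGroup m) : Prop where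
  poissonLie : IsPoissonLieBracket (smoothU m) (bracketU m)
  poisson : IsPoissonBracket (smoothM n d) (bracketM lam)
  poissonAction :
    IsPoissonAction (smoothU m) (bracketU m) (smoothM n d) (bracketM lam) act
  isOpen : IsOpen U
  smooth : ContDiffOn ℝ ∞ (fun v => bMat (J v)) U
  momentum : ∀ (X : uLie m), ∀ v ∈ U, ∀ α : Matrix (Fin n) (Fin d) ℂ →L[ℝ] ℝ,
    poissonM lam v α (pullbackForm J X.1 v) = α (infAct act X v)

/-- The map `λ + v v†`. -/
def phiLeft {n d : ℕ} (lam : ℝ) (v : Matrix (Fin n) (Fin d) ℂ) : Matrix (Fin n) (Fin n) ℂ :=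
  (lam : ℂ) • (1 : Matrix (Fin n) (Fin n) ℂ) + v * vᴴ

/-- The map `(λ + v† v)⁻¹`. -/
def phiRight {n d : ℕ} (lam : ℝ) (v : Matrix (Fin n) (Fin d) ℂ) : Matrix (Fin d) (Fin d) ℂ :=
  ((lam : ℂ) • (1 : Matrix (Fin d) (Fin d) ℂ) + vᴴ * v)⁻¹

end

/-!
# Momentum maps for the Poisson actions of `U(n)` and `U(d)` on matrices

Write `r(Z) = ½ (Z_u - Z_b)` for half the classical r-matrix of the splitting
`gl(m, ℂ) = u(m) ⊕ b(m)`. Up to covectors and traces all the brackets are given by one family of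
Hamiltonian vectors `hamVec ε λ v y = r(v y) v + ε v r(y v) - λ y†`: the bivector on rectangular
matrices is the case `ε = 1` (`poissonM_eq`), and the bracket of `U(m)` is the restriction to
unitary matrices of the case `ε = -1`, `λ = 0` on square matrices (`bracketU_eq`).

The Jacobi identity is therefore proved once, for `ε² = 1` and `λ ε = λ`. For arbitrary functions
it follows from that for linear functions by the symmetry of second derivatives
(`isPoissonBracket_of_hamiltonian`). For linear functions (`cyclic_sum_bracketCovector`) the mixed
terms cancel cyclically, the left and the right r-matrix terms are both evaluated by the modified
classical Yang-Baxter equation (`rMat_yangBaxter`) and give opposite multiples of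
`Im tr (vx [vy, vz])`, and the terms with `λ` cancel because `x† y - y† x` is skew-hermitian.

Multiplicativity of the bracket of `U(m)` and the Poisson property of the two actions are
identities between traces, in which the covectors are moved by translations; for the right action
one also needs that `(Z†)_u = Z_u - Z + Z†` (`kProj_conjTranspose`).

The decomposition `Λ = b b†` exists by the LDL decomposition of `Λ⁻¹`, and it is unique because a
unitary element of `B(m)` is trivial. It is smooth by the inverse function theorem for the map
`b + X ↦ b b† + X` on `b(m) ⊕ u(m)`; the same argument shows that positive definite matrices form
an open set among the hermitian ones.

For the momentum property, differentiating `b b† = λ + v v†` and using that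
`Im tr (X δ b⁻¹) = Im tr ((b⁻¹ X b)_u b⁻¹ δ)` only involves the hermitian part of `b⁻¹ δ` gives
the covector `v† N` with `N = b⁻† (b⁻¹ X b)_u b⁻¹` in `u(n)`. As `b (b⁻¹ X b)_u b⁻¹` and `X`
differ by an element of `b(n)`, it follows that `(v v† N)_u = X - λ N`, and the Hamiltonian vector
is `X v`. The right action is similar, starting from `b† (λ + v† v) b = 1`.
-/

/-! ### The trace form and the splitting of `gl(m, ℂ)` -/

theorem im_trace_conjTranspose {m : ℕ} (A : Matrix (Fin m) (Fin m) ℂ) :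
    Aᴴ.trace.im = -A.trace.im := by
  rw [Matrix.trace_conjTranspose]
  simp

theorem mem_uLie {m : ℕ} {X : Matrix (Fin m) (Fin m) ℂ} : X ∈ uLie m ↔ Xᴴ = -X := Iff.rfl

theorem conj_mem_uLie {m n : ℕ} {X : Matrix (Fin m) (Fin m) ℂ} (hX : X ∈ uLie m)
    (A : Matrix (Fin n) (Fin m) ℂ) : A * X * Aᴴ ∈ uLie n := by
  rw [mem_uLie] at *
  simp [Matrix.conjTranspose_mul, hX, Matrix.mul_assoc]

theorem mul_mem_bLie {m : ℕ} {X Y : Matrix (Fin m) (Fin m) ℂ} (hX : X ∈ bLie m)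
    (hY : Y ∈ bLie m) : X * Y ∈ bLie m := by
  have ht : (X * Y).BlockTriangular id :=
    Matrix.BlockTriangular.mul (fun i j h => hX.1 i j h) (fun i j h => hY.1 i j h)
  refine ⟨fun i j h => ht h, fun i => ?_⟩
  rw [Matrix.mul_apply, Finset.sum_eq_single i]
  · simp [hX.2 i, hY.2 i]
  · intro j _ hj
    rcases lt_or_gt_of_ne hj with h | h
    · rw [hX.1 i j h, zero_mul]
    · rw [hY.1 j i h, mul_zero]
  · simp

theorem im_trace_of_mem_bLie {m : ℕ} {X : Matrix (Fin m) (Fin m) ℂ} (hX : X ∈ bLie m) :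
    X.trace.im = 0 := by
  simp [Matrix.trace, Complex.im_sum, hX.2]

theorem im_trace_mul_of_mem_uLie {m : ℕ} {X Y : Matrix (Fin m) (Fin m) ℂ} (hX : X ∈ uLie m)
    (hY : Y ∈ uLie m) : (X * Y).trace.im = 0 := by
  have h := im_trace_conjTranspose (X * Y)
  rw [Matrix.conjTranspose_mul, mem_uLie.1 hX, mem_uLie.1 hY, neg_mul_neg,
    Matrix.trace_mul_comm] at h
  linarith

theorem uLie_bracket_mem {m : ℕ} {X Y : Matrix (Fin m) (Fin m) ℂ} (hX : X ∈ uLie m)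
    (hY : Y ∈ uLie m) : X * Y - Y * X ∈ uLie m := by
  rw [mem_uLie] at *
  simp [Matrix.conjTranspose_mul, hX, hY]

/-- The intersection of `u(m)` and `b(m)` is zero. -/
theorem eq_zero_of_mem_uLie_of_mem_bLie {m : ℕ} {X : Matrix (Fin m) (Fin m) ℂ}
    (hu : X ∈ uLie m) (hb : X ∈ bLie m) : X = 0 := by
  have hs : ∀ i j, star (X j i) = -X i j := fun i j => congrFun (congrFun hu i) j
  ext i j
  rcases lt_trichotomy i j with h | h | h
  · have := hs i j
    rw [hb.1 j i h, star_zero] at this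
    simpa using this.symm
  · subst h
    have := congrArg Complex.re (hs i i)
    apply Complex.ext
    · simp at this ⊢
      linarith
    · simpa using hb.2 i
  · exact hb.1 i j h

theorem kProj_mem {m : ℕ} (X : Matrix (Fin m) (Fin m) ℂ) : kProj X ∈ uLie m := (kProj_spec X).1

theorem sub_kProj_mem {m : ℕ} (X : Matrix (Fin m) (Fin m) ℂ) : X - kProj X ∈ bLie m :=
  (kProj_spec X).2

theorem kProj_unique {m : ℕ} {X Y : Matrix (Fin m) (Fin m) ℂ} (hY : Y ∈ uLie m)
    (hXY : X - Y ∈ bLie m) : kProj X = Y := by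
  rw [← sub_eq_zero]
  refine eq_zero_of_mem_uLie_of_mem_bLie (sub_mem (kProj_mem X) hY) ?_
  have := sub_mem hXY (sub_kProj_mem X)
  rwa [sub_sub_sub_cancel_left] at this

theorem kProj_of_mem_uLie {m : ℕ} {X : Matrix (Fin m) (Fin m) ℂ} (hX : X ∈ uLie m) :
    kProj X = X :=
  kProj_unique hX (by simp)

theorem kProj_eq_zero_iff {m : ℕ} {X : Matrix (Fin m) (Fin m) ℂ} : kProj X = 0 ↔ X ∈ bLie m := by
  refine ⟨fun h => ?_, fun h => kProj_unique (zero_mem _) (by simpa using h)⟩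
  simpa [h] using sub_kProj_mem X

theorem kProj_add {m : ℕ} (X Y : Matrix (Fin m) (Fin m) ℂ) :
    kProj (X + Y) = kProj X + kProj Y := by
  refine kProj_unique (add_mem (kProj_mem X) (kProj_mem Y)) ?_
  rw [add_sub_add_comm]
  exact add_mem (sub_kProj_mem X) (sub_kProj_mem Y)

theorem kProj_smul {m : ℕ} (c : ℝ) (X : Matrix (Fin m) (Fin m) ℂ) :
    kProj (c • X) = c • kProj X := by
  refine kProj_unique (Submodule.smul_mem _ c (kProj_mem X)) ?_
  rw [← smul_sub]
  exact Submodule.smul_mem _ c (sub_kProj_mem X)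

/-- The projection onto `u(m)` along `b(m)` as a real linear map. -/
noncomputable def kProjL (m : ℕ) : Matrix (Fin m) (Fin m) ℂ →ₗ[ℝ] Matrix (Fin m) (Fin m) ℂ where
  toFun := kProj
  map_add' := kProj_add
  map_smul' := kProj_smul

theorem kProj_conjTranspose {m : ℕ} (X : Matrix (Fin m) (Fin m) ℂ) :
    kProj Xᴴ = kProj X - X + Xᴴ := by
  ext i j
  rcases lt_trichotomy i j with h | h | h
  · simp [kProj, h, h.not_gt]
    ring
  · subst h
    apply Complex.ext
    · simp [kProj]
    · simp [kProj]
  · simp [kProj, h]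

/-- The form `Im tr` is nondegenerate. -/
theorem eq_zero_of_forall_im_trace {m : ℕ} {Y : Matrix (Fin m) (Fin m) ℂ}
    (h : ∀ Z : Matrix (Fin m) (Fin m) ℂ, (Z * Y).trace.im = 0) : Y = 0 := by
  ext i j
  have h1 := h (Matrix.single j i 1)
  have h2 := h (Matrix.single j i Complex.I)
  rw [Matrix.trace_single_mul] at h1 h2
  apply Complex.ext
  · simpa using h2
  · simpa using h1

/-- The projections onto `u(m)` and onto `b(m)` are adjoint for `Im tr`. -/
theorem im_trace_mul_kProj {m : ℕ} (X Y : Matrix (Fin m) (Fin m) ℂ) :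
    (X * kProj Y).trace.im = ((X - kProj X) * Y).trace.im := by
  have h1 := im_trace_mul_of_mem_uLie (kProj_mem X) (kProj_mem Y)
  have h2 := im_trace_of_mem_bLie (mul_mem_bLie (sub_kProj_mem X) (sub_kProj_mem Y))
  simp only [mul_sub, sub_mul, Matrix.trace_sub, Complex.sub_im] at *
  linarith

/-- Half the classical r-matrix: `½ (X_u - X_b)`. -/
noncomputable def rMat {m : ℕ} (X : Matrix (Fin m) (Fin m) ℂ) : Matrix (Fin m) (Fin m) ℂ :=
  kProj X - (1 / 2 : ℝ) • X

theorem rMat_add {m : ℕ} (X Y : Matrix (Fin m) (Fin m) ℂ) : rMat (X + Y) = rMat X + rMat Y := by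
  simp only [rMat, kProj_add, smul_add]
  abel

theorem rMat_smul {m : ℕ} (c : ℝ) (X : Matrix (Fin m) (Fin m) ℂ) :
    rMat (c • X) = c • rMat X := by
  simp only [rMat, kProj_smul, smul_sub, smul_comm c]

theorem im_trace_mul_rMat {m : ℕ} (X Y : Matrix (Fin m) (Fin m) ℂ) :
    (X * rMat Y).trace.im = -(rMat X * Y).trace.im := by
  have h := im_trace_mul_kProj X Y
  simp only [rMat, mul_sub, sub_mul, Matrix.trace_sub, Complex.sub_im, Matrix.mul_smul,
    Matrix.smul_mul, Matrix.trace_smul, Complex.smul_im, smul_eq_mul] at *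
  linarith

theorem im_trace_rMat_mul_of_mem_uLie {m : ℕ} (X : Matrix (Fin m) (Fin m) ℂ)
    {U : Matrix (Fin m) (Fin m) ℂ} (hU : U ∈ uLie m) :
    (rMat X * U).trace.im = -(1 / 2) * (X * U).trace.im := by
  simp only [rMat, sub_mul, Matrix.trace_sub, Complex.sub_im,
    Matrix.smul_mul, Matrix.trace_smul, Complex.smul_im, smul_eq_mul,
    im_trace_mul_of_mem_uLie (kProj_mem X) hU]
  linarith

/-- The modified classical Yang-Baxter equation for `rMat`, contracted with a third matrix by the
invariant form. It holds because `u(m)` and `b(m)` are isotropic subalgebras. -/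
theorem rMat_yangBaxter {m : ℕ} (X Y Z : Matrix (Fin m) (Fin m) ℂ) :
    (X * (rMat Y * rMat Z - rMat Z * rMat Y)).trace.im
      + (Y * (rMat Z * rMat X - rMat X * rMat Z)).trace.im
      + (Z * (rMat X * rMat Y - rMat Y * rMat X)).trace.im
      = -(1 / 4) * (X * (Y * Z - Z * Y)).trace.im := by
  obtain ⟨A, hA, P, hP, rfl, hrX⟩ : ∃ A ∈ uLie m, ∃ P ∈ bLie m, X = A + P ∧
      rMat X = (1 / 2 : ℝ) • (A - P) :=
    ⟨_, kProj_mem X, _, sub_kProj_mem X, by abel, by simp only [rMat]; module⟩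
  obtain ⟨B, hB, Q, hQ, rfl, hrY⟩ : ∃ A ∈ uLie m, ∃ P ∈ bLie m, Y = A + P ∧
      rMat Y = (1 / 2 : ℝ) • (A - P) :=
    ⟨_, kProj_mem Y, _, sub_kProj_mem Y, by abel, by simp only [rMat]; module⟩
  obtain ⟨C, hC, R, hR, rfl, hrZ⟩ : ∃ A ∈ uLie m, ∃ P ∈ bLie m, Z = A + P ∧
      rMat Z = (1 / 2 : ℝ) • (A - P) :=
    ⟨_, kProj_mem Z, _, sub_kProj_mem Z, by abel, by simp only [rMat]; module⟩
  have hu := im_trace_mul_of_mem_uLie hA (uLie_bracket_mem hB hC)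
  have hb := im_trace_of_mem_bLie (mul_mem_bLie hP (sub_mem (mul_mem_bLie hQ hR)
    (mul_mem_bLie hR hQ)))
  have c1 : ∀ S T U : Matrix (Fin m) (Fin m) ℂ,
      (T * (U * S)).trace.im = (S * (T * U)).trace.im := fun S T U => by
    rw [← Matrix.mul_assoc, Matrix.trace_mul_comm]
  have c2 : ∀ S T U : Matrix (Fin m) (Fin m) ℂ,
      (T * (S * U)).trace.im = (S * (U * T)).trace.im := fun S T U => by
    rw [Matrix.trace_mul_comm, Matrix.mul_assoc]
  rw [hrX, hrY, hrZ]
  simp only [mul_sub, sub_mul, mul_add, add_mul, Matrix.mul_smul, Matrix.smul_mul, smul_sub,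
    smul_smul, Matrix.trace_sub, Matrix.trace_add, Matrix.trace_smul, Complex.sub_im,
    Complex.add_im, Complex.smul_im, smul_eq_mul] at hu hb ⊢
  simp only [c1 A, c1 P, c2 A, c2 P]
  linarith

/-! ### Quadratic Poisson tensors on rectangular matrices -/

/-- The Hamiltonian vector at `v` of the covector `w ↦ Im tr (y w)`, for the tensor with quadratic
part given by the r-matrix acting on the left and, with the factor `ε`, on the right, and with
constant part `-λ`. The case `ε = 1` is the Poisson space of matrices, the case `ε = -1`, `λ = 0`
restricts to the Poisson Lie group `U(m)`. -/
noncomputable def hamVec {n d : ℕ} (ε lam : ℝ) (v : Matrix (Fin n) (Fin d) ℂ)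
    (y : Matrix (Fin d) (Fin n) ℂ) : Matrix (Fin n) (Fin d) ℂ :=
  rMat (v * y) * v + ε • (v * rMat (y * v)) - lam • yᴴ

section

variable {n d : ℕ}

theorem hamVec_add (ε lam : ℝ) (v : Matrix (Fin n) (Fin d) ℂ) (y z : Matrix (Fin d) (Fin n) ℂ) :
    hamVec ε lam v (y + z) = hamVec ε lam v y + hamVec ε lam v z := by
  simp only [hamVec, Matrix.mul_add, Matrix.add_mul, rMat_add, smul_add,
    Matrix.conjTranspose_add]
  abel

theorem hamVec_smul (ε lam c : ℝ) (v : Matrix (Fin n) (Fin d) ℂ)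
    (y : Matrix (Fin d) (Fin n) ℂ) : hamVec ε lam v (c • y) = c • hamVec ε lam v y := by
  simp only [hamVec, Matrix.mul_smul, Matrix.smul_mul, rMat_smul, Matrix.conjTranspose_smul,
    star_trivial, smul_add, smul_sub, smul_comm c]

theorem im_trace_mul_hamVec_antisymm (ε lam : ℝ) (v : Matrix (Fin n) (Fin d) ℂ)
    (x y : Matrix (Fin d) (Fin n) ℂ) :
    (x * hamVec ε lam v y).trace.im = -(y * hamVec ε lam v x).trace.im := by
  have h1 : (x * (rMat (v * y) * v)).trace.im = -(y * (rMat (v * x) * v)).trace.im := by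
    have h := im_trace_mul_rMat (v * x) (v * y)
    rw [← Matrix.mul_assoc, Matrix.trace_mul_comm, ← Matrix.mul_assoc, h, ← Matrix.mul_assoc,
      Matrix.trace_mul_comm, Matrix.trace_mul_comm y, Matrix.mul_assoc]
  have h2 : (x * (v * rMat (y * v))).trace.im = -(y * (v * rMat (x * v))).trace.im := by
    rw [← Matrix.mul_assoc, im_trace_mul_rMat, Matrix.trace_mul_comm, Matrix.mul_assoc]
  have h3 : (x * yᴴ).trace.im = -(y * xᴴ).trace.im := by
    rw [← im_trace_conjTranspose, Matrix.conjTranspose_mul, Matrix.conjTranspose_conjTranspose]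
  simp only [hamVec, Matrix.mul_add, Matrix.mul_sub, Matrix.mul_smul, Matrix.trace_add,
    Matrix.trace_sub, Matrix.trace_smul, Complex.add_im, Complex.sub_im, Complex.smul_im,
    smul_eq_mul, h1, h2, h3]
  ring

/-- The covector, in matrix form, of the differential at `v` of the function
`v ↦ Im tr (y (hamVec ε lam v z))`, the bracket of two linear functions. -/
noncomputable def bracketCovector (ε : ℝ) (v : Matrix (Fin n) (Fin d) ℂ)
    (y z : Matrix (Fin d) (Fin n) ℂ) : Matrix (Fin d) (Fin n) ℂ :=
  y * rMat (v * z) - z * rMat (v * y) + ε • (rMat (z * v) * y - rMat (y * v) * z)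

theorem im_trace_bracketCovector_mul_hamVec (ε lam : ℝ) (hε : ε * ε = 1) (hl : lam * ε = lam)
    (v : Matrix (Fin n) (Fin d) ℂ) (x y z : Matrix (Fin d) (Fin n) ℂ) :
    (bracketCovector ε v y z * hamVec ε lam v x).trace.im =
      (v * y * (rMat (v * z) * rMat (v * x))).trace.im
      - (v * z * (rMat (v * y) * rMat (v * x))).trace.im
      + ε * ((v * (rMat (z * v) * (y * rMat (v * x)))).trace.im
        - (v * (rMat (y * v) * (z * rMat (v * x)))).trace.im
        + (v * (rMat (x * v) * (y * rMat (v * z)))).trace.im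
        - (v * (rMat (x * v) * (z * rMat (v * y)))).trace.im)
      + (y * v * (rMat (x * v) * rMat (z * v))).trace.im
      - (z * v * (rMat (x * v) * rMat (y * v))).trace.im
      - lam * ((rMat (v * z) * (xᴴ * y)).trace.im - (rMat (v * y) * (xᴴ * z)).trace.im
        + (rMat (z * v) * (y * xᴴ)).trace.im - (rMat (y * v) * (z * xᴴ)).trace.im) := by
  have t1 : ∀ (p : Matrix (Fin d) (Fin n) ℂ) (r s : Matrix (Fin n) (Fin n) ℂ),
      (p * (r * (s * v))).trace.im = (v * (p * (r * s))).trace.im := fun p r s => by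
    rw [Matrix.trace_mul_comm v]
    simp only [Matrix.mul_assoc]
  have t2 : ∀ (p : Matrix (Fin d) (Fin n) ℂ) (r : Matrix (Fin d) (Fin d) ℂ)
      (s : Matrix (Fin n) (Fin n) ℂ),
      (r * (p * (s * v))).trace.im = (v * (r * (p * s))).trace.im := fun p r s => by
    rw [Matrix.trace_mul_comm v]
    simp only [Matrix.mul_assoc]
  have t3 : ∀ (p : Matrix (Fin d) (Fin n) ℂ) (r : Matrix (Fin n) (Fin n) ℂ)
      (s : Matrix (Fin d) (Fin d) ℂ),
      (p * (r * (v * s))).trace.im = (v * (s * (p * r))).trace.im := fun p r s => by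
    rw [← Matrix.mul_assoc v, Matrix.trace_mul_comm (v * s)]
    simp only [Matrix.mul_assoc]
  have t4 : ∀ (p : Matrix (Fin d) (Fin n) ℂ) (r s : Matrix (Fin d) (Fin d) ℂ),
      (r * (p * (v * s))).trace.im = (p * (v * (s * r))).trace.im := fun p r s => by
    rw [Matrix.trace_mul_comm r]
    simp only [Matrix.mul_assoc]
  have t5 : ∀ (p : Matrix (Fin d) (Fin n) ℂ) (r : Matrix (Fin n) (Fin n) ℂ),
      (p * (r * xᴴ)).trace.im = (r * (xᴴ * p)).trace.im := fun p r => by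
    rw [Matrix.trace_mul_comm p]
    simp only [Matrix.mul_assoc]
  simp only [bracketCovector, hamVec, Matrix.add_mul, Matrix.mul_add, Matrix.sub_mul,
    Matrix.mul_sub, Matrix.mul_smul, Matrix.smul_mul, Matrix.trace_sub, Matrix.trace_add,
    Matrix.trace_smul, Complex.sub_im, Complex.add_im, Complex.smul_im, smul_eq_mul, smul_sub,
    Matrix.mul_assoc, t1, t2, t3, t4, t5]
  linear_combination ((y * (v * (rMat (x * v) * rMat (z * v)))).trace.im
    - (z * (v * (rMat (x * v) * rMat (y * v)))).trace.im) * hε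
    - ((rMat (z * v) * (y * xᴴ)).trace.im - (rMat (y * v) * (z * xᴴ)).trace.im) * hl

/-- The Jacobi identity for linear functions. The quadratic terms cancel by the modified
Yang-Baxter equations for both sizes of matrices, whose right-hand sides agree; the terms with
`λ` cancel since `x† y - y† x` is skew-hermitian. -/
theorem cyclic_sum_bracketCovector (ε lam : ℝ) (hε : ε * ε = 1) (hl : lam * ε = lam)
    (v : Matrix (Fin n) (Fin d) ℂ) (x y z : Matrix (Fin d) (Fin n) ℂ) :
    (bracketCovector ε v y z * hamVec ε lam v x).trace.im
      + (bracketCovector ε v z x * hamVec ε lam v y).trace.im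
      + (bracketCovector ε v x y * hamVec ε lam v z).trace.im = 0 := by
  have hL := rMat_yangBaxter (v * x) (v * y) (v * z)
  have hR := rMat_yangBaxter (x * v) (y * v) (z * v)
  -- the contribution of the constant term, for one pair of covectors
  have hu : ∀ p q r : Matrix (Fin d) (Fin n) ℂ,
      (rMat (v * r) * (pᴴ * q - qᴴ * p)).trace.im =
        -(1 / 2) * (v * r * (pᴴ * q - qᴴ * p)).trace.im := fun p q r =>
    im_trace_rMat_mul_of_mem_uLie _ (by rw [mem_uLie]; simp)
  have hu' : ∀ p q r : Matrix (Fin d) (Fin n) ℂ,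
      (rMat (r * v) * (p * qᴴ - q * pᴴ)).trace.im =
        -(1 / 2) * (r * v * (p * qᴴ - q * pᴴ)).trace.im := fun p q r =>
    im_trace_rMat_mul_of_mem_uLie _ (by rw [mem_uLie]; simp)
  have e1 := hu x y z
  have e2 := hu y z x
  have e3 := hu z x y
  have e4 := hu' y x z
  have e5 := hu' z y x
  have e6 := hu' x z y
  have hc : (x * v * (y * v * (z * v))).trace.im = (v * x * (v * y * (v * z))).trace.im := by
    simp only [Matrix.mul_assoc]
    rw [Matrix.trace_mul_comm v]
    simp only [Matrix.mul_assoc]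
  have hc' : (x * v * (z * v * (y * v))).trace.im = (v * x * (v * z * (v * y))).trace.im := by
    simp only [Matrix.mul_assoc]
    rw [Matrix.trace_mul_comm v]
    simp only [Matrix.mul_assoc]
  have hr : ∀ p q r : Matrix (Fin d) (Fin n) ℂ,
      (p * v * (q * rᴴ)).trace.im = (v * q * (rᴴ * p)).trace.im := fun p q r => by
    rw [Matrix.mul_assoc, Matrix.trace_mul_comm]
    simp only [Matrix.mul_assoc]
  have h1 := im_trace_bracketCovector_mul_hamVec ε lam hε hl v x y z
  have h2 := im_trace_bracketCovector_mul_hamVec ε lam hε hl v y z x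
  have h3 := im_trace_bracketCovector_mul_hamVec ε lam hε hl v z x y
  simp only [Matrix.mul_sub, Matrix.trace_sub, Complex.sub_im, hc, hc', hr]
    at hL hR e1 e2 e3 e4 e5 e6
  linear_combination h1 + h2 + h3 + hL - hR - lam * (e1 + e2 + e3 + e4 + e5 + e6)

/-! ### Poisson brackets from Hamiltonian vector fields -/

/-- A smooth bivector on a vector space, given by the map `V` from covectors to Hamiltonian
vectors, defines a Poisson bracket as soon as the Jacobi identity holds for linear functions: the
second derivatives of the functions cancel by their symmetry. -/
theorem isPoissonBracket_of_hamiltonian {E : Type} [NormedAddCommGroup E] [NormedSpace ℝ E]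
    [FiniteDimensional ℝ E] (A : Subalgebra ℝ (E → ℝ)) (hA : ∀ f, f ∈ A ↔ ContDiff ℝ ∞ f)
    (V : E → (E →L[ℝ] ℝ) → E) (hadd : ∀ v α β, V v (α + β) = V v α + V v β)
    (hsmul : ∀ v (c : ℝ) α, V v (c • α) = c • V v α)
    (hsmooth : ∀ α, ContDiff ℝ ∞ fun v => V v α)
    (anti : ∀ v (α β : E →L[ℝ] ℝ), α (V v β) = -β (V v α))
    (jac : ∀ v (α β γ : E →L[ℝ] ℝ), fderiv ℝ (fun w => β (V w γ)) v (V v α)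
      + fderiv ℝ (fun w => γ (V w α)) v (V v β)
      + fderiv ℝ (fun w => α (V w β)) v (V v γ) = 0) :
    IsPoissonBracket A fun f g v => fderiv ℝ f v (V v (fderiv ℝ g v)) := by
  obtain ⟨W, hW⟩ : ∃ W : E → (E →L[ℝ] ℝ) →L[ℝ] E, ∀ v α, W v α = V v α :=
    ⟨fun v => LinearMap.toContinuousLinearMap ⟨⟨V v, hadd v⟩, hsmul v⟩, fun _ _ => rfl⟩
  simp only [← hW] at *
  have hWs : ContDiff ℝ ∞ W := contDiff_clm_apply_iff.2 hsmooth
  have hd : ∀ f, f ∈ A → ContDiff ℝ ∞ (fderiv ℝ f) := fun f hf =>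
    ((hA f).1 hf).fderiv_right (by norm_cast)
  have hdiff : ∀ f, f ∈ A → ∀ v, DifferentiableAt ℝ f v := fun f hf v =>
    ((hA f).1 hf).differentiable (by simp) v
  have hder : ∀ g ∈ A, ∀ h ∈ A, ∀ v u,
      fderiv ℝ (fun w => fderiv ℝ g w (W w (fderiv ℝ h w))) v u =
        fderiv ℝ (fun w => fderiv ℝ g v (W w (fderiv ℝ h v))) v u
          + fderiv ℝ (fderiv ℝ g) v u (W v (fderiv ℝ h v))
          - fderiv ℝ (fderiv ℝ h) v u (W v (fderiv ℝ g v)) := by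
    intro g hg h hh v u
    have hg' := ((hd g hg).differentiable (by simp) v).hasFDerivAt
    have hh' := ((hd h hh).differentiable (by simp) v).hasFDerivAt
    have hW' := (hWs.differentiable (by simp) v).hasFDerivAt
    have h1 : HasFDerivAt (fun w => fderiv ℝ g v (W w (fderiv ℝ h v))) _ v :=
      (fderiv ℝ g v).hasFDerivAt.comp v (hW'.clm_apply (hasFDerivAt_const (fderiv ℝ h v) v))
    rw [(hg'.clm_apply (hW'.clm_apply hh')).fderiv, h1.fderiv]
    simp only [_root_.add_apply, ContinuousLinearMap.comp_apply,
      ContinuousLinearMap.flip_apply, map_add, _root_.zero_apply, map_zero]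
    rw [anti v (fderiv ℝ g v) (fderiv ℝ (fderiv ℝ h) v u)]
    ring
  have hsymm : ∀ f ∈ A, ∀ v u w, fderiv ℝ (fderiv ℝ f) v u w = fderiv ℝ (fderiv ℝ f) v w u :=
    fun f hf v u w => ((hA f).1 hf).contDiffAt.isSymmSndFDerivAt
      (by simpa using (by exact_mod_cast le_top : ((2 : ℕ∞) : ℕ∞ω) ≤ ((⊤ : ℕ∞) : ℕ∞ω))) u w
  refine ⟨fun f hf g hg => ?_, fun f hf g hg h hh => ?_, fun c f hf h hh => ?_,
    fun f hf g hg => ?_, fun f hf g hg h hh => ?_, fun f hf g hg h hh => ?_⟩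
  · exact (hA _).2 ((hd f hf).clm_apply (hWs.clm_apply (hd g hg)))
  · ext v
    rw [fderiv_add (hdiff f hf v) (hdiff g hg v)]
    rfl
  · ext v
    rw [fderiv_const_smul (hdiff f hf v)]
    rfl
  · ext v
    exact anti v _ _
  · ext v
    rw [fderiv_mul (hdiff g hg v) (hdiff h hh v)]
    simp
    ring
  · ext v
    simp only [Pi.add_apply, Pi.zero_apply]
    rw [anti v (fderiv ℝ f v), anti v (fderiv ℝ g v), anti v (fderiv ℝ h v), hder g hg h hh,
      hder h hh f hf, hder f hf g hg]
    have h0 := jac v (fderiv ℝ f v) (fderiv ℝ g v) (fderiv ℝ h v)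
    rw [hsymm f hf v _ (W v (fderiv ℝ g v)), hsymm g hg v _ (W v (fderiv ℝ h v)),
      hsymm h hh v _ (W v (fderiv ℝ f v))]
    linarith

/-! ### Calculus for linear and bilinear maps of matrices

The instances on spaces of matrices which the calculus library infers from the norm agree with the
algebraic ones only up to unfolding. The rules are therefore proved for abstract
finite-dimensional spaces, in terms of maps that are not bundled with their continuity. -/

section Calculus

variable {E F G H : Type} [NormedAddCommGroup E] [NormedSpace ℝ E]
  [NormedAddCommGroup F] [NormedSpace ℝ F] [NormedAddCommGroup G] [NormedSpace ℝ G]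
  [NormedAddCommGroup H] [NormedSpace ℝ H]

theorem LinearMap.contDiffAt_comp [FiniteDimensional ℝ F] (L : F →ₗ[ℝ] G) {k : ℕ∞ω} {f : E → F}
    {x : E} (hf : ContDiffAt ℝ k f x) : ContDiffAt ℝ k (fun x => L (f x)) x :=
  (LinearMap.toContinuousLinearMap L).contDiff.contDiffAt.comp x hf

theorem LinearMap.hasDerivAt_comp [FiniteDimensional ℝ F] (L : F →ₗ[ℝ] G) {f : ℝ → F} {f' : F}
    {t : ℝ} (hf : HasDerivAt f f' t) : HasDerivAt (fun t => L (f t)) (L f') t :=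
  (LinearMap.toContinuousLinearMap L).hasFDerivAt.comp_hasDerivAt t hf

theorem LinearMap.contDiffAt_bilin [FiniteDimensional ℝ F] [FiniteDimensional ℝ G]
    (B : F →ₗ[ℝ] G →ₗ[ℝ] H) {k : ℕ∞ω} {f : E → F} {g : E → G} {x : E}
    (hf : ContDiffAt ℝ k f x) (hg : ContDiffAt ℝ k g x) :
    ContDiffAt ℝ k (fun x => B (f x) (g x)) x :=
  (B.toContinuousBilinearMap.contDiff.contDiffAt.comp x hf).clm_apply hg

theorem LinearMap.hasDerivAt_bilin [FiniteDimensional ℝ F] [FiniteDimensional ℝ G]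
    (B : F →ₗ[ℝ] G →ₗ[ℝ] H) {f : ℝ → F} {g : ℝ → G} {t : ℝ} {f' : F} {g' : G}
    (hf : HasDerivAt f f' t) (hg : HasDerivAt g g' t) :
    HasDerivAt (fun t => B (f t) (g t)) (B f' (g t) + B (f t) g') t := by
  have h := B.toContinuousBilinearMap.hasFDerivAt.comp_hasDerivAt t hf
  exact h.clm_apply hg

theorem HasFDerivAt.line {f : E → F} {f' : E →L[ℝ] F} {v : E} (hf : HasFDerivAt f f' v) (u : E) :
    HasDerivAt (fun t : ℝ => f (v + t • u)) (f' u) 0 := by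
  have hline : HasDerivAt (fun t : ℝ => v + t • u) u 0 := by
    simpa using ((hasDerivAt_id (0 : ℝ)).smul_const u)
  refine HasFDerivAt.comp_hasDerivAt (0 : ℝ) ?_ hline
  simpa using hf

end Calculus

section MatrixCalculus

variable {a b c : ℕ} {E : Type} [NormedAddCommGroup E] [NormedSpace ℝ E]

/-- Matrix multiplication as a real bilinear map. -/
noncomputable def matMulL (a b c : ℕ) : Matrix (Fin a) (Fin b) ℂ →ₗ[ℝ]
    Matrix (Fin b) (Fin c) ℂ →ₗ[ℝ] Matrix (Fin a) (Fin c) ℂ :=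
  LinearMap.mk₂ ℝ (fun A B => A * B)
    (fun _ _ _ => Matrix.add_mul _ _ _) (fun _ _ _ => Matrix.smul_mul _ _ _)
    (fun _ _ _ => Matrix.mul_add _ _ _) (fun _ _ _ => Matrix.mul_smul _ _ _)

theorem ContDiffAt.matMul {k : ℕ∞ω} {f : E → Matrix (Fin a) (Fin b) ℂ}
    {g : E → Matrix (Fin b) (Fin c) ℂ} {x : E} (hf : ContDiffAt ℝ k f x)
    (hg : ContDiffAt ℝ k g x) : ContDiffAt ℝ k (fun x => f x * g x) x :=
  LinearMap.contDiffAt_bilin (matMulL a b c) hf hg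

theorem ContDiff.matMul {k : ℕ∞ω} {f : E → Matrix (Fin a) (Fin b) ℂ}
    {g : E → Matrix (Fin b) (Fin c) ℂ} (hf : ContDiff ℝ k f) (hg : ContDiff ℝ k g) :
    ContDiff ℝ k (fun x => f x * g x) :=
  contDiff_iff_contDiffAt.2 fun _ => hf.contDiffAt.matMul hg.contDiffAt

theorem HasDerivAt.matMul {f : ℝ → Matrix (Fin a) (Fin b) ℂ} {g : ℝ → Matrix (Fin b) (Fin c) ℂ}
    {t : ℝ} {f' : Matrix (Fin a) (Fin b) ℂ} {g' : Matrix (Fin b) (Fin c) ℂ}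
    (hf : HasDerivAt f f' t) (hg : HasDerivAt g g' t) :
    HasDerivAt (fun t => f t * g t) (f' * g t + f t * g') t :=
  LinearMap.hasDerivAt_bilin (matMulL a b c) hf hg

/-- The imaginary part of the trace as a real linear functional. -/
noncomputable def imTraceL (m : ℕ) : Matrix (Fin m) (Fin m) ℂ →ₗ[ℝ] ℝ :=
  Complex.imLm ∘ₗ Matrix.traceLinearMap (Fin m) ℝ ℂ

/-- `rMat` as a real linear map. -/
noncomputable def rMatL (m : ℕ) : Matrix (Fin m) (Fin m) ℂ →ₗ[ℝ] Matrix (Fin m) (Fin m) ℂ :=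
  ⟨⟨rMat, rMat_add⟩, rMat_smul⟩

/-- The conjugate transpose as a real linear map. -/
noncomputable def conjTransposeL (a b : ℕ) :
    Matrix (Fin a) (Fin b) ℂ →ₗ[ℝ] Matrix (Fin b) (Fin a) ℂ :=
  ⟨⟨fun v => vᴴ, Matrix.conjTranspose_add⟩, fun c v => by simp⟩

end MatrixCalculus

/-! ### The Poisson bracket on rectangular matrices -/

theorem covMat_unique {α : Matrix (Fin n) (Fin d) ℂ →L[ℝ] ℝ} {y : Matrix (Fin d) (Fin n) ℂ}
    (h : ∀ w, α w = (y * w).trace.im) : covMat α = y := by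
  ext j i
  have h1 := h (Matrix.single i j 1)
  have h2 := h (Matrix.single i j Complex.I)
  rw [Matrix.trace_mul_single] at h1 h2
  apply Complex.ext
  · simpa [covMat] using h2
  · simpa [covMat] using h1

theorem covMat_add (α β : Matrix (Fin n) (Fin d) ℂ →L[ℝ] ℝ) :
    covMat (α + β) = covMat α + covMat β :=
  covMat_unique fun w => by
    simp [covMat_spec α w, covMat_spec β w, Matrix.add_mul]

theorem covMat_smul (c : ℝ) (α : Matrix (Fin n) (Fin d) ℂ →L[ℝ] ℝ) :
    covMat (c • α) = c • covMat α :=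
  covMat_unique fun w => by
    simp [covMat_spec α w]

theorem contDiff_hamVec (ε lam : ℝ) (y : Matrix (Fin d) (Fin n) ℂ) :
    ContDiff ℝ ∞ fun v : Matrix (Fin n) (Fin d) ℂ => hamVec ε lam v y := by
  refine contDiff_iff_contDiffAt.2 fun v => ?_
  have h1 : ContDiffAt ℝ ∞ (fun v : Matrix (Fin n) (Fin d) ℂ => rMat (v * y)) v :=
    (rMatL n).contDiffAt_comp (contDiffAt_id.matMul contDiffAt_const)
  have h2 : ContDiffAt ℝ ∞ (fun v : Matrix (Fin n) (Fin d) ℂ => rMat (y * v)) v :=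
    (rMatL d).contDiffAt_comp (contDiffAt_const.matMul contDiffAt_id)
  exact ((h1.matMul contDiffAt_id).add ((contDiffAt_id.matMul h2).const_smul ε)).sub
    contDiffAt_const

theorem hasDerivAt_hamVec_line (ε lam : ℝ) (v u : Matrix (Fin n) (Fin d) ℂ)
    (z : Matrix (Fin d) (Fin n) ℂ) :
    HasDerivAt (fun t : ℝ => hamVec ε lam (v + t • u) z)
      (rMat (u * z) * v + rMat (v * z) * u + ε • (u * rMat (z * v) + v * rMat (z * u))) 0 := by
  have hline : HasDerivAt (fun t : ℝ => v + t • u) u 0 := (hasFDerivAt_id v).line u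
  have hL : HasDerivAt (fun t : ℝ => rMat ((v + t • u) * z)) (rMat (u * z)) 0 := by
    have h : HasDerivAt (fun t : ℝ => rMat ((v + t • u) * z)) (rMat (u * z +
        (v + (0 : ℝ) • u) * (0 : Matrix (Fin d) (Fin n) ℂ))) 0 :=
      (rMatL n).hasDerivAt_comp (hline.matMul (hasDerivAt_const 0 z))
    rwa [Matrix.mul_zero, add_zero] at h
  have hR : HasDerivAt (fun t : ℝ => rMat (z * (v + t • u))) (rMat (z * u)) 0 := by
    have h : HasDerivAt (fun t : ℝ => rMat (z * (v + t • u)))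
        (rMat ((0 : Matrix (Fin d) (Fin n) ℂ) * (v + (0 : ℝ) • u) + z * u)) 0 :=
      (rMatL d).hasDerivAt_comp ((hasDerivAt_const 0 z).matMul hline)
    rwa [Matrix.zero_mul, zero_add] at h
  have h1 := hL.matMul hline
  have h2 := (hline.matMul hR)
  simp only [zero_smul, add_zero] at h1 h2
  have h2' : HasDerivAt (fun t : ℝ => ε • ((v + t • u) * rMat (z * (v + t • u))))
    (ε • (u * rMat (z * v) + v * rMat (z * u))) 0 := h2.const_smul ε
  exact (h1.add h2').sub_const (lam • zᴴ)

theorem fderiv_im_trace_mul_hamVec (ε lam : ℝ) (v u : Matrix (Fin n) (Fin d) ℂ)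
    (y z : Matrix (Fin d) (Fin n) ℂ) :
    fderiv ℝ (fun w => (y * hamVec ε lam w z).trace.im) v u =
      (bracketCovector ε v y z * u).trace.im := by
  have h : HasDerivAt (fun t : ℝ => (y * hamVec ε lam (v + t • u) z).trace.im) _ 0 :=
    (imTraceL d).hasDerivAt_comp ((hasDerivAt_const (0 : ℝ) y).matMul
      (hasDerivAt_hamVec_line ε lam v u z))
  have hf : DifferentiableAt ℝ (fun w => (y * hamVec ε lam w z).trace.im) v :=
    ((imTraceL d).contDiffAt_comp (contDiff_const.matMul
      (contDiff_hamVec ε lam z)).contDiffAt).differentiableAt (by simp)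
  refine ((hf.hasFDerivAt.line u).unique h).trans ?_
  change (_ : Matrix (Fin d) (Fin d) ℂ).trace.im = _
  rw [Matrix.zero_mul, zero_add]
  have c1 : (y * (rMat (u * z) * v)).trace.im = -(z * (rMat (v * y) * u)).trace.im := by
    rw [← Matrix.mul_assoc, Matrix.trace_mul_comm, ← Matrix.mul_assoc, im_trace_mul_rMat,
      ← Matrix.mul_assoc, Matrix.trace_mul_comm]
  have c2 : (y * (u * rMat (z * v))).trace.im = (rMat (z * v) * (y * u)).trace.im := by
    rw [← Matrix.mul_assoc, Matrix.trace_mul_comm]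
  have c3 : (y * (v * rMat (z * u))).trace.im = -(rMat (y * v) * (z * u)).trace.im := by
    rw [← Matrix.mul_assoc, im_trace_mul_rMat]
  simp only [bracketCovector, Matrix.mul_add, Matrix.add_mul, Matrix.sub_mul, Matrix.mul_smul,
    Matrix.smul_mul, Matrix.trace_add, Matrix.trace_sub, Matrix.trace_smul, Complex.add_im,
    Complex.sub_im, Complex.smul_im, smul_eq_mul, Matrix.mul_assoc, c1, c2, c3]
  ring

/-- The bracket of functions of matrices with Hamiltonian vectors given by `hamVec`. -/
noncomputable def bracketHam (ε lam : ℝ) (f h : Matrix (Fin n) (Fin d) ℂ → ℝ)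
    (v : Matrix (Fin n) (Fin d) ℂ) : ℝ :=
  (covMat (fderiv ℝ f v) * hamVec ε lam v (covMat (fderiv ℝ h v))).trace.im

theorem isPoissonBracket_bracketHam (ε lam : ℝ) (hε : ε * ε = 1) (hl : lam * ε = lam) :
    IsPoissonBracket (smoothM n d) (bracketHam ε lam) := by
  have hb : (bracketHam ε lam : (Matrix (Fin n) (Fin d) ℂ → ℝ) → _ → _) =
      fun f h v => fderiv ℝ f v (hamVec ε lam v (covMat (fderiv ℝ h v))) := by
    ext f h v
    rw [covMat_spec (fderiv ℝ f v)]
    rfl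
  rw [hb]
  refine isPoissonBracket_of_hamiltonian (smoothM n d) (fun f => Iff.rfl)
    (fun v α => hamVec ε lam v (covMat α)) (fun v α β => ?_) (fun v c α => ?_)
    (fun α => contDiff_hamVec ε lam _) (fun v α β => ?_) (fun v α β γ => ?_)
  · exact (congrArg _ (covMat_add α β)).trans (hamVec_add ε lam v _ _)
  · exact (congrArg _ (covMat_smul c α)).trans (hamVec_smul ε lam c v _)
  · refine (covMat_spec α _).trans ((im_trace_mul_hamVec_antisymm ε lam v _ _).trans ?_)
    exact congrArg _ (covMat_spec β _).symm
  · have key : ∀ β γ : Matrix (Fin n) (Fin d) ℂ →L[ℝ] ℝ,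
        (fun w => β (hamVec ε lam w (covMat γ))) =
          fun w => (covMat β * hamVec ε lam w (covMat γ)).trace.im := fun β γ =>
      funext fun w => covMat_spec β _
    have e := fun (α β γ : Matrix (Fin n) (Fin d) ℂ →L[ℝ] ℝ) =>
      (congrArg (fun F => fderiv ℝ F v (hamVec ε lam v (covMat α))) (key β γ)).trans
        (fderiv_im_trace_mul_hamVec ε lam v _ (covMat β) (covMat γ))
    refine (congrArg₂ (· + ·) (congrArg₂ (· + ·) (e α β γ) (e β γ α)) (e γ α β)).trans ?_
    exact cyclic_sum_bracketCovector ε lam hε hl v _ _ _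

theorem im_trace_mul_hamVec (ε lam : ℝ) (v : Matrix (Fin n) (Fin d) ℂ)
    (x y : Matrix (Fin d) (Fin n) ℂ) :
    (x * hamVec ε lam v y).trace.im =
      (v * x * kProj (v * y)).trace.im + ε * (x * v * kProj (y * v)).trace.im
        - (1 + ε) / 2 * (x * v * y * v).trace.im - lam * (x * yᴴ).trace.im := by
  have c1 : (x * (kProj (v * y) * v)).trace.im = (v * x * kProj (v * y)).trace.im := by
    rw [← Matrix.mul_assoc, Matrix.trace_mul_comm, ← Matrix.mul_assoc]
  rw [← c1]
  simp only [hamVec, rMat, Matrix.mul_add, Matrix.mul_sub, Matrix.sub_mul, Matrix.mul_smul,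
    Matrix.smul_mul, Matrix.trace_add, Matrix.trace_sub, Matrix.trace_smul, Complex.add_im,
    Complex.sub_im, Complex.smul_im, smul_eq_mul, smul_sub, Matrix.mul_assoc]
  ring

theorem poissonM_eq (lam : ℝ) (v : Matrix (Fin n) (Fin d) ℂ)
    (α β : Matrix (Fin n) (Fin d) ℂ →L[ℝ] ℝ) :
    poissonM lam v α β = (covMat α * hamVec 1 lam v (covMat β)).trace.im := by
  rw [im_trace_mul_hamVec]
  simp only [poissonM]
  ring

theorem bracketM_eq (lam : ℝ) : (bracketM lam : (Matrix (Fin n) (Fin d) ℂ → ℝ) → _ → _) =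
    bracketHam 1 lam := by
  ext f h v
  exact poissonM_eq lam v _ _

theorem isPoissonBracket_bracketM (lam : ℝ) :
    IsPoissonBracket (smoothM n d) (bracketM lam) := by
  rw [bracketM_eq]
  exact isPoissonBracket_bracketHam 1 lam (by norm_num) (by ring)

end

/-! ### The Poisson Lie group `U(m)` -/

theorem hasDerivAt_exp_smul_zero {A : Type} [NormedRing A] [NormedAlgebra ℝ A] [CompleteSpace A]
    (X : A) : HasDerivAt (fun t : ℝ => NormedSpace.exp (t • X)) X 0 := by
  simpa using hasDerivAt_exp_smul_const (𝕂 := ℝ) X 0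

theorem hasDerivAt_expU {m : ℕ} (X : uLie m) :
    HasDerivAt (fun t : ℝ => (expU (t • X)).1) X.1 0 :=
  @hasDerivAt_exp_smul_zero (Matrix (Fin m) (Fin m) ℂ) Matrix.linftyOpNormedRing
    Matrix.linftyOpNormedAlgebra _ X.1

theorem expU_zero_smul {m : ℕ} (X : uLie m) : expU ((0 : ℝ) • X) = 1 := by
  apply Subtype.ext
  simp [expU]

theorem unitary_coe_inv {m : ℕ} (k : Matrix.unitaryGroup (Fin m) ℂ) : (k⁻¹).1 = (k.1)ᴴ := rfl

theorem unitary_conjTranspose_mul_self {m : ℕ} (k : Matrix.unitaryGroup (Fin m) ℂ) :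
    (k.1)ᴴ * k.1 = 1 := Matrix.mem_unitaryGroup_iff'.1 k.2

theorem unitary_mul_conjTranspose_self {m : ℕ} (k : Matrix.unitaryGroup (Fin m) ℂ) :
    k.1 * (k.1)ᴴ = 1 := Matrix.mem_unitaryGroup_iff.1 k.2

/-- An element of `b(m)` is determined by its pairing with `u(m)`. -/
theorem eq_of_forall_imTr_eq {m : ℕ} {β γ : Matrix (Fin m) (Fin m) ℂ} (hβ : β ∈ bLie m)
    (hγ : γ ∈ bLie m) (h : ∀ ξ : uLie m, imTr ξ.1 β = imTr ξ.1 γ) : β = γ := by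
  rw [← sub_eq_zero]
  refine eq_zero_of_forall_im_trace fun Z => ?_
  have h1 := h ⟨kProj Z, kProj_mem Z⟩
  have h2 := im_trace_of_mem_bLie (mul_mem_bLie (sub_kProj_mem Z) (sub_mem hβ hγ))
  simp only [imTr, sub_mul, mul_sub, Matrix.trace_sub, Complex.sub_im] at h1 h2 ⊢
  linarith

theorem imTr_sub_kProj {m : ℕ} (ξ : uLie m) (Z : Matrix (Fin m) (Fin m) ℂ) :
    imTr ξ.1 (Z - kProj Z) = (ξ.1 * Z).trace.im := by
  rw [imTr, mul_sub, Matrix.trace_sub, Complex.sub_im,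
    im_trace_mul_of_mem_uLie ξ.2 (kProj_mem Z), sub_zero]

/-- If `ξ ↦ Im tr (ξ Z)` is the left differential of `f`, then `D_k f` is the component of `Z` in
`b(m)`. -/
theorem leftDeriv_eq_of_forall {m : ℕ} {f : Matrix.unitaryGroup (Fin m) ℂ → ℝ}
    {k : Matrix.unitaryGroup (Fin m) ℂ} {Z : Matrix (Fin m) (Fin m) ℂ}
    (h : ∀ ξ : uLie m, deriv (fun t : ℝ => f (expU (t • ξ) * k)) 0 = (ξ.1 * Z).trace.im) :
    leftDeriv f k = Z - kProj Z := by
  have hZ : Z - kProj Z ∈ bLie m ∧ ∀ ξ : uLie m,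
      deriv (fun t : ℝ => f (expU (t • ξ) * k)) 0 = imTr ξ.1 (Z - kProj Z) :=
    ⟨sub_kProj_mem Z, fun ξ => by rw [h, imTr_sub_kProj]⟩
  have hs : leftDeriv f k ∈ bLie m ∧ ∀ ξ : uLie m,
      deriv (fun t : ℝ => f (expU (t • ξ) * k)) 0 = imTr ξ.1 (leftDeriv f k) :=
    Classical.epsilon_spec (p := fun β => β ∈ bLie m ∧ ∀ ξ : uLie m,
      deriv (fun t : ℝ => f (expU (t • ξ) * k)) 0 = imTr ξ.1 β) ⟨_, hZ⟩
  exact eq_of_forall_imTr_eq hs.1 hZ.1 fun ξ => by rw [← hs.2 ξ, hZ.2 ξ]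

/-- If `ξ ↦ Im tr (ξ Z)` is the right differential of `f`, then `D'_k f` is the component of `Z`
in `b(m)`. -/
theorem rightDeriv_eq_of_forall {m : ℕ} {f : Matrix.unitaryGroup (Fin m) ℂ → ℝ}
    {k : Matrix.unitaryGroup (Fin m) ℂ} {Z : Matrix (Fin m) (Fin m) ℂ}
    (h : ∀ ξ : uLie m, deriv (fun t : ℝ => f (k * expU (t • ξ))) 0 = (ξ.1 * Z).trace.im) :
    rightDeriv f k = Z - kProj Z := by
  have hZ : Z - kProj Z ∈ bLie m ∧ ∀ ξ : uLie m,
      deriv (fun t : ℝ => f (k * expU (t • ξ))) 0 = imTr ξ.1 (Z - kProj Z) :=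
    ⟨sub_kProj_mem Z, fun ξ => by rw [h, imTr_sub_kProj]⟩
  have hs : rightDeriv f k ∈ bLie m ∧ ∀ ξ : uLie m,
      deriv (fun t : ℝ => f (k * expU (t • ξ))) 0 = imTr ξ.1 (rightDeriv f k) :=
    Classical.epsilon_spec (p := fun β => β ∈ bLie m ∧ ∀ ξ : uLie m,
      deriv (fun t : ℝ => f (k * expU (t • ξ))) 0 = imTr ξ.1 β) ⟨_, hZ⟩
  exact eq_of_forall_imTr_eq hs.1 hZ.1 fun ξ => by rw [← hs.2 ξ, hZ.2 ξ]

theorem differentiableAt_of_smooth {n d : ℕ} {F : Matrix (Fin n) (Fin d) ℂ → ℝ}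
    (hF : ContDiff ℝ ∞ F) (v : Matrix (Fin n) (Fin d) ℂ) : DifferentiableAt ℝ F v :=
  hF.differentiable (by simp) v

/-- The chain rule along a curve, with the covector written as a matrix. -/
theorem hasDerivAt_comp_curve {n d : ℕ} {F : Matrix (Fin n) (Fin d) ℂ → ℝ} (hF : ContDiff ℝ ∞ F)
    {c : ℝ → Matrix (Fin n) (Fin d) ℂ} {c' : Matrix (Fin n) (Fin d) ℂ} {t : ℝ}
    (hc : HasDerivAt c c' t) :
    HasDerivAt (fun s => F (c s)) (covMat (fderiv ℝ F (c t)) * c').trace.im t := by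
  have h : HasDerivAt (fun s => F (c s)) (fderiv ℝ F (c t) c') t :=
    (differentiableAt_of_smooth hF (c t)).hasFDerivAt.comp_hasDerivAt t hc
  rwa [covMat_spec] at h

/-- The bracket of `U(m)` is the restriction of the bracket of smooth functions of matrices with
`ε = -1` and `λ = 0`. -/
theorem bracketU_eq {m : ℕ} {f h : Matrix.unitaryGroup (Fin m) ℂ → ℝ}
    {F H : Matrix (Fin m) (Fin m) ℂ → ℝ} (hF : ContDiff ℝ ∞ F) (hH : ContDiff ℝ ∞ H)
    (hf : ∀ k, f k = F k.1) (hh : ∀ k, h k = H k.1) (k : Matrix.unitaryGroup (Fin m) ℂ) :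
    bracketU m f h k = bracketHam (-1) 0 F H k.1 := by
  have hl : leftDeriv f k = _ := leftDeriv_eq_of_forall
      (Z := k.1 * covMat (fderiv ℝ F k.1)) fun ξ => by
    have hc : HasDerivAt (fun t : ℝ => (expU (t • ξ)).1 * k.1) _ 0 :=
      (hasDerivAt_expU ξ).matMul (hasDerivAt_const (0 : ℝ) k.1)
    have h1 := hasDerivAt_comp_curve hF hc
    rw [expU_zero_smul, Matrix.mul_zero, add_zero,
      show ((1 : Matrix.unitaryGroup (Fin m) ℂ).1) = 1 from rfl, one_mul] at h1
    have h2 : (fun t : ℝ => f (expU (t • ξ) * k)) = fun t : ℝ => F ((expU (t • ξ)).1 * k.1) :=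
      funext fun t => hf _
    rw [h2, h1.deriv, Matrix.trace_mul_comm, Matrix.mul_assoc]
  have hr : rightDeriv h k = _ := rightDeriv_eq_of_forall
      (Z := covMat (fderiv ℝ H k.1) * k.1) fun ξ => by
    have hc : HasDerivAt (fun t : ℝ => k.1 * (expU (t • ξ)).1) _ 0 :=
      (hasDerivAt_const (0 : ℝ) k.1).matMul (hasDerivAt_expU ξ)
    have h1 := hasDerivAt_comp_curve hH hc
    rw [expU_zero_smul, Matrix.zero_mul, zero_add,
      show ((1 : Matrix.unitaryGroup (Fin m) ℂ).1) = 1 from rfl, mul_one] at h1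
    have h2 : (fun t : ℝ => h (k * expU (t • ξ))) = fun t : ℝ => H (k.1 * (expU (t • ξ)).1) :=
      funext fun t => hh _
    rw [h2, h1.deriv, ← Matrix.mul_assoc, Matrix.trace_mul_comm]
  rw [bracketU, hl, hr, bracketHam, im_trace_mul_hamVec, imTr, unitary_coe_inv]
  generalize covMat (fderiv ℝ F k.1) = x
  generalize covMat (fderiv ℝ H k.1) = y
  have hk := unitary_mul_conjTranspose_self k
  have hk' := unitary_conjTranspose_mul_self k
  have h1 := im_trace_mul_kProj (k.1 * x) (k.1 * y)
  have h2 := im_trace_mul_of_mem_uLie (kProj_mem (k.1 * x))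
    (conj_mem_uLie (kProj_mem (y * k.1)) k.1)
  have h3 : (k.1 * x * (k.1 * kProj (y * k.1) * (k.1)ᴴ)).trace.im =
      (x * k.1 * kProj (y * k.1)).trace.im := by
    rw [← Matrix.mul_assoc, Matrix.trace_mul_comm, ← Matrix.mul_assoc, ← Matrix.mul_assoc,
      ← Matrix.mul_assoc, hk', one_mul]
  have h4 : k.1 * (y * k.1 - kProj (y * k.1)) * (k.1)ᴴ =
      k.1 * y - k.1 * kProj (y * k.1) * (k.1)ᴴ := by
    rw [mul_sub, sub_mul, ← Matrix.mul_assoc, Matrix.mul_assoc _ _ (k.1)ᴴ, hk, mul_one]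
  rw [h4, mul_sub, Matrix.trace_sub, Complex.sub_im, ← h1, sub_mul, Matrix.trace_sub,
    Complex.sub_im, h2, h3]
  ring

/-- All properties are inherited from the bracket on matrices, since it extends the bracket of the
restrictions to `U(m)`. -/
theorem isPoissonBracket_bracketU {m : ℕ} :
    IsPoissonBracket (smoothU m) (bracketU m) := by
  have P := isPoissonBracket_bracketHam (n := m) (d := m) (-1) 0 (by norm_num) (by norm_num)
  refine ⟨?_, ?_, ?_, ?_, ?_, ?_⟩
  · rintro f ⟨F, hF, hf⟩ g ⟨G, hG, hg⟩
    exact ⟨_, P.mem F hF G hG, fun k => bracketU_eq hF hG hf hg k⟩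
  · rintro f ⟨F, hF, hf⟩ g ⟨G, hG, hg⟩ h ⟨H, hH, hh⟩
    ext k
    rw [bracketU_eq (F := F + G) (hF.add hG) hH (fun k => by simp [hf, hg]) hh,
      P.add_left F hF G hG H hH]
    simp [bracketU_eq hF hH hf hh, bracketU_eq hG hH hg hh]
  · rintro c f ⟨F, hF, hf⟩ h ⟨H, hH, hh⟩
    ext k
    rw [bracketU_eq (F := c • F) (hF.const_smul c) hH (fun k => by simp [hf]) hh,
      P.smul_left c F hF H hH]
    simp [bracketU_eq hF hH hf hh]
  · rintro f ⟨F, hF, hf⟩ g ⟨G, hG, hg⟩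
    ext k
    rw [bracketU_eq hF hG hf hg, P.antisymm F hF G hG]
    simp [bracketU_eq hG hF hg hf]
  · rintro f ⟨F, hF, hf⟩ g ⟨G, hG, hg⟩ h ⟨H, hH, hh⟩
    ext k
    rw [bracketU_eq (H := G * H) hF (hG.mul hH) hf (fun k => by simp [hg, hh]),
      P.leibniz F hF G hG H hH]
    simp [bracketU_eq hF hG hf hg, bracketU_eq hF hH hf hh, hg, hh]
  · rintro f ⟨F, hF, hf⟩ g ⟨G, hG, hg⟩ h ⟨H, hH, hh⟩
    ext k
    have e := congrFun (P.jacobi F hF G hG H hH) k.1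
    simpa [bracketU_eq hF (P.mem G hG H hH) hf (bracketU_eq hG hH hg hh),
      bracketU_eq hG (P.mem H hH F hF) hg (bracketU_eq hH hF hh hf),
      bracketU_eq hH (P.mem F hF G hG) hh (bracketU_eq hF hG hf hg)] using e

/-- The covector of a function precomposed with a linear map of matrices. -/
theorem covMat_fderiv_comp {a b n d : ℕ} {F : Matrix (Fin n) (Fin d) ℂ → ℝ} (hF : ContDiff ℝ ∞ F)
    (L : Matrix (Fin a) (Fin b) ℂ →ₗ[ℝ] Matrix (Fin n) (Fin d) ℂ) (v : Matrix (Fin a) (Fin b) ℂ)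
    {y : Matrix (Fin b) (Fin a) ℂ}
    (h : ∀ w, (covMat (fderiv ℝ F (L v)) * L w).trace.im = (y * w).trace.im) :
    ContDiff ℝ ∞ (fun w => F (L w)) ∧ covMat (fderiv ℝ (fun w => F (L w)) v) = y := by
  have hs : ContDiff ℝ ∞ (fun w => F (L w)) := contDiff_iff_contDiffAt.2 fun w =>
    hF.contDiffAt.comp w (L.contDiffAt_comp contDiffAt_id)
  refine ⟨hs, covMat_unique fun w => ?_⟩
  have h1 := (differentiableAt_of_smooth hs v).hasFDerivAt.line w
  have h2 := hasDerivAt_comp_curve hF (L.hasDerivAt_comp ((hasFDerivAt_id v).line w))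
  simp only [zero_smul, add_zero, id_eq] at h2
  exact (h1.unique h2).trans (h w)

/-! ### Multiplicativity and Poisson actions -/

theorem covMat_fderiv_comp_mul_left {a n d : ℕ} {F : Matrix (Fin n) (Fin d) ℂ → ℝ}
    (hF : ContDiff ℝ ∞ F) (g : Matrix (Fin n) (Fin a) ℂ) (v : Matrix (Fin a) (Fin d) ℂ) :
    ContDiff ℝ ∞ (fun w : Matrix (Fin a) (Fin d) ℂ => F (g * w)) ∧
      covMat (fderiv ℝ (fun w : Matrix (Fin a) (Fin d) ℂ => F (g * w)) v) =
        covMat (fderiv ℝ F (g * v)) * g :=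
  covMat_fderiv_comp hF (matMulL n a d g) v fun w => by rw [Matrix.mul_assoc]; rfl

theorem covMat_fderiv_comp_mul_right {b n d : ℕ} {F : Matrix (Fin n) (Fin d) ℂ → ℝ}
    (hF : ContDiff ℝ ∞ F) (g : Matrix (Fin b) (Fin d) ℂ) (v : Matrix (Fin n) (Fin b) ℂ) :
    ContDiff ℝ ∞ (fun w : Matrix (Fin n) (Fin b) ℂ => F (w * g)) ∧
      covMat (fderiv ℝ (fun w : Matrix (Fin n) (Fin b) ℂ => F (w * g)) v) =
        g * covMat (fderiv ℝ F (v * g)) :=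
  covMat_fderiv_comp hF ((matMulL n b d).flip g) v fun w => by
    rw [Matrix.mul_assoc, Matrix.trace_mul_comm g, Matrix.mul_assoc]; rfl

theorem covMat_fderiv_comp_mul_conjTranspose {n d : ℕ} {F : Matrix (Fin n) (Fin d) ℂ → ℝ}
    (hF : ContDiff ℝ ∞ F) (v : Matrix (Fin n) (Fin d) ℂ) (A : Matrix (Fin d) (Fin d) ℂ) :
    ContDiff ℝ ∞ (fun B : Matrix (Fin d) (Fin d) ℂ => F (v * Bᴴ)) ∧
      covMat (fderiv ℝ (fun B : Matrix (Fin d) (Fin d) ℂ => F (v * Bᴴ)) A) =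
        -(covMat (fderiv ℝ F (v * Aᴴ)) * v)ᴴ :=
  covMat_fderiv_comp hF (matMulL n d d v ∘ₗ conjTransposeL d d) A fun B => by
    change (covMat (fderiv ℝ F (v * Aᴴ)) * (v * Bᴴ)).trace.im = _
    rw [neg_mul, Matrix.trace_neg, Complex.neg_im, ← im_trace_conjTranspose,
      Matrix.conjTranspose_mul, Matrix.conjTranspose_conjTranspose, Matrix.trace_mul_comm (Bᴴ),
      Matrix.mul_assoc]

theorem isPoissonLieBracket_bracketU (m : ℕ) : IsPoissonLieBracket (smoothU m) (bracketU m) := by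
  refine ⟨isPoissonBracket_bracketU, ?_, ?_, ?_⟩
  · rintro f ⟨F, hF, hf⟩ g
    exact ⟨_, (covMat_fderiv_comp_mul_left hF g.1 0).1, fun k => hf (g * k)⟩
  · rintro f ⟨F, hF, hf⟩ g
    exact ⟨_, (covMat_fderiv_comp_mul_right hF g.1 0).1, fun k => hf (k * g)⟩
  · rintro f ⟨F, hF, hf⟩ h ⟨H, hH, hh⟩ k l
    have hFl := covMat_fderiv_comp_mul_left hF k.1 l.1
    have hHl := covMat_fderiv_comp_mul_left hH k.1 l.1
    have hFr := covMat_fderiv_comp_mul_right hF l.1 k.1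
    have hHr := covMat_fderiv_comp_mul_right hH l.1 k.1
    rw [bracketU_eq hFr.1 hHr.1 (fun g => hf (g * l)) (fun g => hh (g * l)),
      bracketU_eq hFl.1 hHl.1 (fun g => hf (k * g)) (fun g => hh (k * g)),
      bracketU_eq hF hH hf hh, bracketHam, bracketHam, bracketHam, hFl.2, hHl.2, hFr.2, hHr.2,
      im_trace_mul_hamVec, im_trace_mul_hamVec, im_trace_mul_hamVec]
    simp only [Submonoid.coe_mul, Matrix.mul_assoc]
    ring

theorem isPoissonAction_actLeft (n d : ℕ) (lam : ℝ) :
    IsPoissonAction (smoothU n) (bracketU n) (smoothM n d) (bracketM lam) actLeft := by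
  refine ⟨fun v => by simp [actLeft], fun g h v => by simp [actLeft, Matrix.mul_assoc], ?_, ?_, ?_⟩
  · exact fun f hf v => ⟨_, (covMat_fderiv_comp_mul_right hf v 0).1, fun _ => rfl⟩
  · exact fun f hf g => (covMat_fderiv_comp_mul_left hf g.1 0).1
  · intro f hf h hh k v
    have hFl := covMat_fderiv_comp_mul_left hf k.1 v
    have hHl := covMat_fderiv_comp_mul_left hh k.1 v
    have hFr := covMat_fderiv_comp_mul_right hf v k.1
    have hHr := covMat_fderiv_comp_mul_right hh v k.1
    simp only [actLeft, bracketM_eq]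
    rw [bracketU_eq hFr.1 hHr.1 (fun g => rfl) (fun g => rfl), bracketHam, bracketHam,
      bracketHam, hFl.2, hHl.2, hFr.2, hHr.2,
      im_trace_mul_hamVec, im_trace_mul_hamVec, im_trace_mul_hamVec]
    generalize covMat (fderiv ℝ f (k.1 * v)) = x
    generalize covMat (fderiv ℝ h (k.1 * v)) = y
    have hk : ∀ z : Matrix (Fin n) (Fin d) ℂ, k.1 * ((k.1)ᴴ * z) = z := fun z => by
      rw [← Matrix.mul_assoc, unitary_mul_conjTranspose_self, Matrix.one_mul]
    simp only [Matrix.conjTranspose_mul, Matrix.mul_assoc, hk]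
    ring

/-- The tensor of the bracket of `U(d)` on covectors of the form `-X†`, which are those of functions
composed with an orbit map `k ↦ v k†`. -/
theorem im_trace_mul_hamVec_conjTranspose {d : ℕ} (k : Matrix.unitaryGroup (Fin d) ℂ)
    (X Y : Matrix (Fin d) (Fin d) ℂ) :
    ((-Xᴴ) * hamVec (-1) 0 k.1 (-Yᴴ)).trace.im =
      (X * (k.1)ᴴ * kProj (Y * (k.1)ᴴ)).trace.im
        - ((k.1)ᴴ * X * kProj ((k.1)ᴴ * Y)).trace.im := by
  -- how `Im tr (U W_u)` changes when both matrices are replaced by their adjoints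
  have key : ∀ U W : Matrix (Fin d) (Fin d) ℂ, (Uᴴ * kProj Wᴴ).trace.im =
      (U * kProj W).trace.im - (U * W).trace.im + (U * Wᴴ).trace.im := fun U W => by
    have h1 : (Uᴴ * kProj Wᴴ).trace.im = (U * kProj Wᴴ).trace.im := by
      have h := im_trace_conjTranspose (U * kProj Wᴴ)
      rw [Matrix.conjTranspose_mul, mem_uLie.1 (kProj_mem Wᴴ), Matrix.trace_mul_comm,
        Matrix.mul_neg, Matrix.trace_neg, Complex.neg_im] at h
      linarith
    rw [h1, kProj_conjTranspose, mul_add, mul_sub, Matrix.trace_add, Matrix.trace_sub,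
      Complex.add_im, Complex.sub_im]
  have hn : hamVec (-1) 0 k.1 (-Yᴴ) = -hamVec (-1) 0 k.1 Yᴴ := by
    rw [← neg_one_smul ℝ Yᴴ, hamVec_smul, neg_one_smul]
  have e1 := key (X * (k.1)ᴴ) (Y * (k.1)ᴴ)
  have e2 := key ((k.1)ᴴ * X) ((k.1)ᴴ * Y)
  have hk := unitary_mul_conjTranspose_self k
  have hk' := unitary_conjTranspose_mul_self k
  have h1 : (X * (k.1)ᴴ * (Y * (k.1)ᴴ)).trace.im = ((k.1)ᴴ * X * ((k.1)ᴴ * Y)).trace.im := by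
    simp only [Matrix.mul_assoc]
    rw [Matrix.trace_mul_comm (k.1)ᴴ]
    simp only [Matrix.mul_assoc]
  have h2 : (X * (k.1)ᴴ * (Y * (k.1)ᴴ)ᴴ).trace.im =
      ((k.1)ᴴ * X * ((k.1)ᴴ * Y)ᴴ).trace.im := by
    simp only [Matrix.conjTranspose_mul, Matrix.conjTranspose_conjTranspose]
    rw [Matrix.mul_assoc X, ← Matrix.mul_assoc (k.1)ᴴ k.1, hk', one_mul,
      Matrix.trace_mul_comm ((k.1)ᴴ * X),
      Matrix.mul_assoc Yᴴ, ← Matrix.mul_assoc k.1, hk, one_mul, Matrix.trace_mul_comm]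
  rw [hn, neg_mul_neg, im_trace_mul_hamVec]
  simp only [Matrix.conjTranspose_mul, Matrix.conjTranspose_conjTranspose] at e1 e2 h2
  linarith

theorem isPoissonAction_actRight (n d : ℕ) (lam : ℝ) :
    IsPoissonAction (smoothU d) (bracketU d) (smoothM n d) (bracketM lam) actRight := by
  refine ⟨fun v => by simp [actRight], fun g h v => by simp [actRight, Matrix.mul_assoc], ?_, ?_,
    ?_⟩
  · exact fun f hf v => ⟨_, (covMat_fderiv_comp_mul_conjTranspose hf v 0).1, fun _ => rfl⟩
  · exact fun f hf g => (covMat_fderiv_comp_mul_right hf (g⁻¹).1 0).1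
  · intro f hf h hh k v
    have hFl := covMat_fderiv_comp_mul_right hf (k.1)ᴴ v
    have hHl := covMat_fderiv_comp_mul_right hh (k.1)ᴴ v
    have hFr := covMat_fderiv_comp_mul_conjTranspose hf v k.1
    have hHr := covMat_fderiv_comp_mul_conjTranspose hh v k.1
    simp only [actRight, unitary_coe_inv, bracketM_eq]
    rw [bracketU_eq hFr.1 hHr.1 (fun g => rfl) (fun g => rfl), bracketHam, bracketHam,
      bracketHam, hFl.2, hHl.2, hFr.2, hHr.2,
      im_trace_mul_hamVec_conjTranspose, im_trace_mul_hamVec, im_trace_mul_hamVec]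
    generalize covMat (fderiv ℝ f (v * (k.1)ᴴ)) = x
    generalize covMat (fderiv ℝ h (v * (k.1)ᴴ)) = y
    have h1 : ((k.1)ᴴ * x * ((k.1)ᴴ * y)ᴴ).trace.im = (x * yᴴ).trace.im := by
      rw [Matrix.conjTranspose_mul, Matrix.conjTranspose_conjTranspose, ← Matrix.mul_assoc,
        Matrix.trace_mul_comm, Matrix.mul_assoc (k.1)ᴴ, ← Matrix.mul_assoc k.1,
        unitary_mul_conjTranspose_self, one_mul]
    have h2 : ((k.1)ᴴ * x * v * ((k.1)ᴴ * y) * v).trace.im =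
        (x * (v * (k.1)ᴴ) * y * (v * (k.1)ᴴ)).trace.im := by
      simp only [Matrix.mul_assoc]
      rw [Matrix.trace_mul_comm (k.1)ᴴ]
      simp only [Matrix.mul_assoc]
    rw [h1, h2]
    simp only [Matrix.mul_assoc]
    ring

/-! ### Positive definite matrices and the group `B(m)` -/

theorem bMat_mem_bLie {m : ℕ} (b : BGroup m) : bMat b ∈ bLie m :=
  ⟨b.2.1, fun i => (Complex.pos_iff.1 (b.2.2 i)).2.symm⟩

theorem bMat_mul {m : ℕ} (b c : BGroup m) : bMat (b * c) = bMat b * bMat c := rfl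

theorem bMat_mul_inv {m : ℕ} (b : BGroup m) : bMat b * bMat b⁻¹ = 1 := by
  rw [← bMat_mul, mul_inv_cancel]
  rfl

theorem bMat_inv_mul {m : ℕ} (b : BGroup m) : bMat b⁻¹ * bMat b = 1 := by
  rw [← bMat_mul, inv_mul_cancel]
  rfl

theorem bMat_injective {m : ℕ} : Function.Injective (bMat : BGroup m → _) := fun _ _ h =>
  Subtype.ext (Units.ext h)

theorem exists_bMat_eq {m : ℕ} {X : Matrix (Fin m) (Fin m) ℂ} (hX : ∀ i j, j < i → X i j = 0)
    (hd : ∀ i, 0 < X i i) : ∃ b : BGroup m, bMat b = X := by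
  have ht : X.BlockTriangular id := fun i j h => hX i j h
  have hdet : IsUnit X.det := by
    rw [Matrix.det_of_isUpperTriangular ht, isUnit_iff_ne_zero]
    exact Finset.prod_ne_zero_iff.2 fun i _ => (hd i).ne'
  exact ⟨⟨Matrix.GeneralLinearGroup.mkOfDetNeZero X hdet.ne_zero, hX, hd⟩, rfl⟩

theorem posDef_bMat_mul {m : ℕ} (b : BGroup m) : (bMat b * (bMat b)ᴴ).PosDef := by
  refine Matrix.PosDef.mul_conjTranspose_self _ ?_
  exact Function.LeftInverse.injective (g := fun x => Matrix.vecMul x (bMat b⁻¹)) fun x => by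
    simp [Matrix.vecMul_vecMul, bMat_mul_inv]

/-- Uniqueness of the decomposition: a unitary element of `B(m)` is trivial. -/
theorem injective_bMat_mul (m : ℕ) :
    Function.Injective fun b : BGroup m => bMat b * (bMat b)ᴴ := by
  intro b c h
  simp only at h
  have hA : bMat (c⁻¹ * b) * (bMat (c⁻¹ * b))ᴴ = 1 := by
    rw [bMat_mul, Matrix.conjTranspose_mul, Matrix.mul_assoc, ← Matrix.mul_assoc (bMat b), h,
      Matrix.mul_assoc, ← Matrix.conjTranspose_mul, bMat_inv_mul, Matrix.conjTranspose_one,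
      mul_one, bMat_inv_mul]
  rw [← inv_mul_eq_one.1 (?_ : c⁻¹ * b = 1)]
  generalize c⁻¹ * b = a at hA
  have hinv : (bMat a)ᴴ = bMat a⁻¹ := by
    rw [← one_mul (bMat a)ᴴ, ← bMat_inv_mul a, Matrix.mul_assoc, hA, mul_one]
  have hup : ∀ i j, i < j → bMat a i j = 0 := fun i j hij => by
    have h1 : (bMat a)ᴴ j i = 0 := by
      rw [hinv]
      exact (bMat_mem_bLie a⁻¹).1 j i hij
    simpa using h1
  apply bMat_injective
  change bMat a = 1
  ext i j
  rcases lt_trichotomy i j with hij | rfl | hij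
  · rw [hup i j hij, Matrix.one_apply_ne hij.ne]
  · have h1 : (bMat a * (bMat a)ᴴ) i i = 1 := by rw [hA, Matrix.one_apply_eq]
    rw [Matrix.mul_apply, Finset.sum_eq_single i (fun j _ hj => ?_) (by simp),
      Matrix.conjTranspose_apply] at h1
    · obtain ⟨hre, him⟩ := Complex.pos_iff.1 (a.2.2 i)
      change 0 < (bMat a i i).re at hre
      change 0 = (bMat a i i).im at him
      have h2 := congrArg Complex.re h1
      simp [← him] at h2
      rw [Matrix.one_apply_eq]
      apply Complex.ext
      · rw [Complex.one_re]
        nlinarith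
      · rw [← him, Complex.one_im]
    · rcases lt_or_gt_of_ne hj with h | h
      · rw [(bMat_mem_bLie a).1 i j h, zero_mul]
      · rw [hup i j h, zero_mul]
  · rw [(bMat_mem_bLie a).1 i j hij, Matrix.one_apply_ne hij.ne']

/-- Existence of the decomposition, from the LDL decomposition of the inverse matrix: if `L` is
lower triangular and `L Λ⁻¹ L†` is diagonal, then `Λ` is `L†` times a diagonal matrix times `L`. -/
theorem exists_bMat_mul_eq {m : ℕ} {Λ : Matrix (Fin m) (Fin m) ℂ} (hΛ : Λ.PosDef) :
    ∃ b : BGroup m, bMat b * (bMat b)ᴴ = Λ := by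
  have hS : (Λ⁻¹).PosDef := hΛ.inv
  obtain ⟨T, e, hT, hTu, hTS⟩ : ∃ (T : Matrix (Fin m) (Fin m) ℂ) (e : Fin m → ℂ),
      (∀ i j, i < j → T i j = 0) ∧ IsUnit T.det ∧ T * Λ⁻¹ * Tᴴ = Matrix.diagonal e :=
    ⟨LDL.lowerInv hS, LDL.diagEntries hS, fun i j h => LDL.lowerInv_triangular hS h,
      Matrix.isUnit_det_of_invertible _, (LDL.diag_eq_lowerInv_conj hS).symm⟩
  have hTi : T⁻¹ * T = 1 := Matrix.nonsing_inv_mul T hTu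
  have hTi' : T * T⁻¹ = 1 := Matrix.mul_nonsing_inv T hTu
  have hΛu : IsUnit Λ.det := (Matrix.isUnit_iff_isUnit_det Λ).1 hΛ.isUnit
  have he : ∀ i, 0 < e i := by
    have hpos : (Matrix.diagonal e).PosDef := by
      rw [← hTS]
      refine hS.mul_mul_conjTranspose_same ?_
      exact Function.LeftInverse.injective (g := fun x => Matrix.vecMul x T⁻¹) fun x => by
        simp [Matrix.vecMul_vecMul, hTi']
    exact Matrix.posDef_diagonal_iff.1 hpos
  have htri : T.BlockTriangular OrderDual.toDual := fun i j h => hT i j h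
  have hTd : ∀ i, T i i ≠ 0 := by
    rw [Matrix.det_of_isLowerTriangular T htri, isUnit_iff_ne_zero] at hTu
    exact fun i => Finset.prod_ne_zero_iff.1 hTu i (Finset.mem_univ i)
  have heq : Λ = Tᴴ * Matrix.diagonal (fun i => (e i)⁻¹) * T := by
    have h1 : Matrix.diagonal (fun i => (e i)⁻¹) * (T * Λ⁻¹ * Tᴴ) = 1 := by
      rw [hTS, Matrix.diagonal_mul_diagonal, ← Matrix.diagonal_one]
      congr 1
      ext i
      exact inv_mul_cancel₀ (he i).ne'
    have h2 : Matrix.diagonal (fun i => (e i)⁻¹) * (T * Λ⁻¹) * Tᴴ = 1 := by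
      rw [← h1]
      simp only [Matrix.mul_assoc]
    have h3 := mul_eq_one_comm.1 h2
    have h4 : (Tᴴ * Matrix.diagonal (fun i => (e i)⁻¹) * T) * Λ⁻¹ = 1 := by
      rw [← h3]
      simp only [Matrix.mul_assoc]
    rw [← one_mul Λ, ← h4, Matrix.mul_assoc _ Λ⁻¹, Matrix.nonsing_inv_mul Λ hΛu, mul_one]
  -- the diagonal factor is a square root of `e⁻¹` with phases making the diagonal positive
  let r : Fin m → ℝ := fun i => (‖T i i‖ * Real.sqrt (e i).re)⁻¹
  have hr : ∀ i, 0 < r i := fun i => inv_pos.2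
    (mul_pos (norm_pos_iff.2 (hTd i)) (Real.sqrt_pos.2 (Complex.pos_iff.1 (he i)).1))
  let c : Fin m → ℂ := fun i => T i i * (r i : ℂ)
  have hcc : ∀ i, c i * star (c i) = (e i)⁻¹ := fun i => by
    have h1 : e i = ((e i).re : ℂ) := Complex.ext rfl (Complex.pos_iff.1 (he i)).2.symm
    have h2 : (r i) ^ 2 * ‖T i i‖ ^ 2 = ((e i).re)⁻¹ := by
      have h3 := Real.sq_sqrt (Complex.pos_iff.1 (he i)).1.le
      have h4 := norm_ne_zero_iff.2 (hTd i)
      have h5 := (Real.sqrt_pos.2 (Complex.pos_iff.1 (he i)).1).ne'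
      simp only [r]
      rw [mul_inv, mul_pow, inv_pow, inv_pow, h3]
      field_simp
    have h6 : c i * star (c i) = (((r i) ^ 2 * ‖T i i‖ ^ 2 : ℝ) : ℂ) := by
      simp only [c, star_mul', Complex.star_def, Complex.conj_ofReal]
      rw [mul_mul_mul_comm, Complex.mul_conj, Complex.normSq_eq_norm_sq]
      push_cast
      ring
    rw [h6, h2, Complex.ofReal_inv, ← h1]
  obtain ⟨b, hb⟩ := exists_bMat_eq (X := Tᴴ * Matrix.diagonal c)
    (fun i j h => by simp [Matrix.mul_diagonal, hT j i h]) (fun i => by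
      rw [Matrix.mul_diagonal, Matrix.conjTranspose_apply]
      simp only [c]
      rw [← mul_assoc, mul_comm (star (T i i)), Complex.star_def, Complex.mul_conj]
      exact mul_pos (by exact_mod_cast Complex.normSq_pos.2 (hTd i)) (by exact_mod_cast hr i))
  refine ⟨b, ?_⟩
  rw [hb, heq, Matrix.conjTranspose_mul, Matrix.conjTranspose_conjTranspose,
    Matrix.diagonal_conjTranspose, Matrix.mul_assoc, ← Matrix.mul_assoc (Matrix.diagonal c),
    Matrix.diagonal_mul_diagonal, Matrix.mul_assoc]
  congr 3
  ext i
  exact hcc i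

theorem bOf_spec {m : ℕ} {Λ : Matrix (Fin m) (Fin m) ℂ} (hΛ : Λ.PosDef) :
    bMat (bOf Λ) * (bMat (bOf Λ))ᴴ = Λ :=
  Classical.epsilon_spec (p := fun b : BGroup m => bMat b * (bMat b)ᴴ = Λ) (exists_bMat_mul_eq hΛ)

theorem bOf_bMat_mul {m : ℕ} (b : BGroup m) : bOf (bMat b * (bMat b)ᴴ) = b :=
  injective_bMat_mul m (bOf_spec (posDef_bMat_mul b))

theorem bijOn_bMat_mul (m : ℕ) : Set.BijOn (fun b : BGroup m => bMat b * (bMat b)ᴴ) Set.univ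
    {Λ : Matrix (Fin m) (Fin m) ℂ | Λ.PosDef} :=
  ⟨fun b _ => posDef_bMat_mul b, (injective_bMat_mul m).injOn, fun _ hΛ =>
    let ⟨b, hb⟩ := exists_bMat_mul_eq hΛ
    ⟨b, Set.mem_univ b, hb⟩⟩

/-! ### Smoothness of the decomposition -/

/-- The inverse function theorem, for a map whose directional derivatives at a point vanish only in
the direction zero. -/
theorem exists_contDiffAt_rightInverse {E : Type} [NormedAddCommGroup E] [NormedSpace ℝ E]
    [FiniteDimensional ℝ E] {f : E → E} (hf : ContDiff ℝ ∞ f) (a : E)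
    (h : ∀ u, HasDerivAt (fun t : ℝ => f (a + t • u)) 0 0 → u = 0) :
    ∃ g : E → E, ContDiffAt ℝ ∞ g (f a) ∧ g (f a) = a ∧ ∀ᶠ y in nhds (f a), f (g y) = y := by
  have hc : CompleteSpace E := FiniteDimensional.complete ℝ E
  have hd : HasFDerivAt f (fderiv ℝ f a) a := (hf.differentiable (by simp) a).hasFDerivAt
  have hinj : Function.Injective (fderiv ℝ f a) := by
    rw [injective_iff_map_eq_zero]
    exact fun u hu => h u (hu ▸ hd.line u)
  let e : E ≃L[ℝ] E := (LinearEquiv.ofInjectiveEndo (fderiv ℝ f a).toLinearMap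
    hinj).toContinuousLinearEquiv
  have hd' : HasFDerivAt f (e : E →L[ℝ] E) a := by
    convert hd
    ext u
    rfl
  have hn : (∞ : ℕ∞ω) ≠ 0 := by simp
  refine ⟨hf.contDiffAt.localInverse hd' hn, hf.contDiffAt.to_localInverse hd' hn,
    hf.contDiffAt.localInverse_apply_image hd' hn, ?_⟩
  exact (hf.contDiffAt.hasStrictFDerivAt' hd' hn).eventually_right_inverse

/-- The map `b + X ↦ b b† + X`, for `b` in `b(m)` and `X` in `u(m)`. -/
noncomputable def squareMap {m : ℕ} (X : Matrix (Fin m) (Fin m) ℂ) : Matrix (Fin m) (Fin m) ℂ :=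
  (X - kProj X) * (X - kProj X)ᴴ + kProj X

theorem contDiff_squareMap (m : ℕ) : ContDiff ℝ ∞ (squareMap (m := m)) := by
  refine contDiff_iff_contDiffAt.2 fun X => ?_
  have h1 : ContDiffAt ℝ ∞ (fun X : Matrix (Fin m) (Fin m) ℂ => kProj X) X :=
    (kProjL m).contDiffAt_comp contDiffAt_id
  have h2 : ContDiffAt ℝ ∞ (fun X : Matrix (Fin m) (Fin m) ℂ => (X - kProj X)ᴴ) X :=
    (conjTransposeL m m).contDiffAt_comp (contDiffAt_id.sub h1)
  exact ((contDiffAt_id.sub h1).matMul h2).add h1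

theorem eq_zero_of_hasDerivAt_squareMap {m : ℕ} (b : BGroup m) {u : Matrix (Fin m) (Fin m) ℂ}
    (h : HasDerivAt (fun t : ℝ => squareMap (bMat b + t • u)) 0 0) : u = 0 := by
  have hb : kProj (bMat b) = 0 := kProj_eq_zero_iff.2 (bMat_mem_bLie b)
  have hline : HasDerivAt (fun t : ℝ => bMat b + t • u) u 0 := (hasFDerivAt_id (bMat b)).line u
  have hk : HasDerivAt (fun t : ℝ => kProj (bMat b + t • u)) (kProj u) 0 :=
    (kProjL m).hasDerivAt_comp hline
  have hs : HasDerivAt (fun t : ℝ => bMat b + t • u - kProj (bMat b + t • u)) (u - kProj u) 0 :=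
    hline.sub hk
  have hs' : HasDerivAt (fun t : ℝ => (bMat b + t • u - kProj (bMat b + t • u))ᴴ)
      (u - kProj u)ᴴ 0 := (conjTransposeL m m).hasDerivAt_comp hs
  have h1 : HasDerivAt (fun t : ℝ => squareMap (bMat b + t • u)) _ 0 := (hs.matMul hs').add hk
  have h2 := h1.unique h
  simp only [zero_smul, add_zero, hb, sub_zero] at h2
  have hub := sub_kProj_mem u
  have huu := kProj_mem u
  generalize hp : u - kProj u = p at *
  -- the first part of the derivative is hermitian, the second one is skew-hermitian
  have h3 := congrArg Matrix.conjTranspose h2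
  simp only [Matrix.conjTranspose_add, Matrix.conjTranspose_mul,
    Matrix.conjTranspose_conjTranspose, mem_uLie.1 huu, Matrix.conjTranspose_zero] at h3
  have h4 : kProj u = 0 := by
    have : (2 : ℝ) • kProj u = 0 := by
      rw [two_smul]
      calc kProj u + kProj u = (p * (bMat b)ᴴ + bMat b * pᴴ + kProj u)
            - (bMat b * pᴴ + p * (bMat b)ᴴ + -kProj u) := by abel
        _ = 0 := by rw [h2, h3, sub_zero]
    simpa using this
  have h5 : p * (bMat b)ᴴ + bMat b * pᴴ = 0 := by rwa [h4, add_zero] at h2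
  have h6 : bMat b⁻¹ * p = 0 := by
    refine eq_zero_of_mem_uLie_of_mem_bLie ?_ (mul_mem_bLie (bMat_mem_bLie _) hub)
    have h7 : bMat b⁻¹ * (p * (bMat b)ᴴ + bMat b * pᴴ) * (bMat b⁻¹)ᴴ = 0 := by
      rw [h5, mul_zero, zero_mul]
    have e1 : (bMat b)ᴴ * (bMat b⁻¹)ᴴ = 1 := by
      rw [← Matrix.conjTranspose_mul, bMat_inv_mul, Matrix.conjTranspose_one]
    rw [mul_add, add_mul, Matrix.mul_assoc, Matrix.mul_assoc, e1, mul_one, ← Matrix.mul_assoc,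
      bMat_inv_mul, one_mul, add_comm] at h7
    rw [mem_uLie, Matrix.conjTranspose_mul]
    exact eq_neg_of_add_eq_zero_left h7
  have h8 : p = 0 := by rw [← one_mul p, ← bMat_mul_inv b, Matrix.mul_assoc, h6, mul_zero]
  rw [h8, h4, sub_zero] at hp
  exact hp

/-- Near a positive definite matrix the hermitian matrices are positive definite and their
decomposition is smooth. -/
theorem exists_contDiffAt_eq_bOf {m : ℕ} {Λ₀ : Matrix (Fin m) (Fin m) ℂ} (hΛ₀ : Λ₀.PosDef) :
    ∃ g : Matrix (Fin m) (Fin m) ℂ → Matrix (Fin m) (Fin m) ℂ, ContDiffAt ℝ ∞ g Λ₀ ∧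
      ∀ᶠ Λ in nhds Λ₀, Λᴴ = Λ → Λ.PosDef ∧ bMat (bOf Λ) = g Λ := by
  obtain ⟨b, rfl⟩ := exists_bMat_mul_eq hΛ₀
  have hb : squareMap (bMat b) = bMat b * (bMat b)ᴴ := by
    rw [squareMap, kProj_eq_zero_iff.2 (bMat_mem_bLie b), sub_zero, add_zero]
  obtain ⟨g, hg, hgb, hev⟩ := exists_contDiffAt_rightInverse (contDiff_squareMap m) (bMat b)
    fun u hu => eq_zero_of_hasDerivAt_squareMap b hu
  rw [hb] at hg hgb hev
  refine ⟨g, hg, ?_⟩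
  have hpos : ∀ᶠ Λ in nhds (bMat b * (bMat b)ᴴ), ∀ i, 0 < (g Λ i i).re := by
    rw [Filter.eventually_all]
    intro i
    have hcont : ContinuousAt (fun Λ => (g Λ i i).re) (bMat b * (bMat b)ᴴ) :=
      Complex.continuous_re.continuousAt.comp
        ((continuous_apply_apply i i).continuousAt.comp hg.continuousAt)
    refine hcont.eventually_const_lt ?_
    change 0 < (g (bMat b * (bMat b)ᴴ) i i).re
    rw [hgb]
    exact (Complex.pos_iff.1 (b.2.2 i)).1
  filter_upwards [hev, hpos] with Λ h1 h2 hΛ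
  have hk : kProj (g Λ) = 0 := by
    have h3 := hΛ
    rw [← h1, squareMap, Matrix.conjTranspose_add, Matrix.conjTranspose_mul,
      Matrix.conjTranspose_conjTranspose, mem_uLie.1 (kProj_mem (g Λ)), add_right_inj] at h3
    have : (2 : ℝ) • kProj (g Λ) = 0 := by
      rw [two_smul]
      nth_rewrite 1 [← h3]
      exact neg_add_cancel _
    simpa using this
  have hgb := kProj_eq_zero_iff.1 hk
  obtain ⟨c, hc⟩ := exists_bMat_eq hgb.1
    fun i => Complex.pos_iff.2 ⟨h2 i, (hgb.2 i).symm⟩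
  have hΛc : bMat c * (bMat c)ᴴ = Λ := by
    refine Eq.trans ?_ h1
    rw [hc, squareMap, hk, sub_zero, add_zero]
  rw [← hΛc, bOf_bMat_mul]
  exact ⟨posDef_bMat_mul c, by rw [hΛc, hc]⟩

theorem contDiffAt_bOf_comp {m : ℕ} {E : Type} [NormedAddCommGroup E] [NormedSpace ℝ E]
    {h : E → Matrix (Fin m) (Fin m) ℂ} {v : E} (hs : ContDiffAt ℝ ∞ h v)
    (hh : ∀ w, (h w)ᴴ = h w) (hv : (h v).PosDef) :
    ContDiffAt ℝ ∞ (fun w => bMat (bOf (h w))) v ∧ ∀ᶠ w in nhds v, (h w).PosDef := by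
  obtain ⟨g, hg, hev⟩ := exists_contDiffAt_eq_bOf hv
  have hev' := hs.continuousAt.eventually hev
  refine ⟨(hg.comp v hs).congr_of_eventuallyEq ?_, ?_⟩
  · filter_upwards [hev'] with w hw using (hw (hh w)).2
  · filter_upwards [hev'] with w hw using (hw (hh w)).1

/-! ### The momentum maps -/

/-- Smoothness of the inverse in a normed algebra, transported to a space with another norm.
Matrices carry the sup norm here, which is not submultiplicative. -/
theorem contDiffAt_ringInverse_transport {E A : Type} [NormedAddCommGroup E] [NormedSpace ℝ E]
    [FiniteDimensional ℝ E] [NormedRing A] [NormedAlgebra ℝ A] [FiniteDimensional ℝ A]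
    (e : E ≃ₗ[ℝ] A) {x : E} (hx : IsUnit (e x)) :
    ContDiffAt ℝ ∞ (fun y => e.symm (Ring.inverse (e y))) x := by
  have hc : CompleteSpace A := FiniteDimensional.complete ℝ A
  obtain ⟨u, hu⟩ := hx
  refine e.symm.toLinearMap.contDiffAt_comp (ContDiffAt.comp x (g := Ring.inverse) ?_
    (e.toLinearMap.contDiffAt_comp contDiffAt_id))
  change ContDiffAt ℝ ∞ Ring.inverse (e x)
  rw [← hu]
  exact contDiffAt_ringInverse ℝ u

theorem contDiffAt_matrix_inv {m : ℕ} {X : Matrix (Fin m) (Fin m) ℂ} (hX : IsUnit X) :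
    ContDiffAt ℝ ∞ (fun Y : Matrix (Fin m) (Fin m) ℂ => Y⁻¹) X := by
  simp only [Matrix.nonsing_inv_eq_ringInverse]
  exact @contDiffAt_ringInverse_transport (Matrix (Fin m) (Fin m) ℂ) (Matrix (Fin m) (Fin m) ℂ)
    Matrix.normedAddCommGroup Matrix.normedSpace _ Matrix.linftyOpNormedRing
    Matrix.linftyOpNormedAlgebra _ (LinearEquiv.refl ℝ _) X hX

section

variable {n d : ℕ}

theorem contDiff_phiLeft (lam : ℝ) :
    ContDiff ℝ ∞ (phiLeft lam : Matrix (Fin n) (Fin d) ℂ → _) :=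
  contDiff_iff_contDiffAt.2 fun _ => contDiffAt_const.add
    (contDiffAt_id.matMul ((conjTransposeL n d).contDiffAt_comp contDiffAt_id))

theorem phiLeft_conjTranspose (lam : ℝ) (v : Matrix (Fin n) (Fin d) ℂ) :
    (phiLeft lam v)ᴴ = phiLeft lam v := by
  simp [phiLeft]

theorem phiRight_eq (lam : ℝ) (v : Matrix (Fin n) (Fin d) ℂ) :
    phiRight lam v = (phiLeft lam vᴴ)⁻¹ := by
  rw [phiRight, phiLeft, Matrix.conjTranspose_conjTranspose]

theorem phiRight_conjTranspose (lam : ℝ) (v : Matrix (Fin n) (Fin d) ℂ) :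
    (phiRight lam v)ᴴ = phiRight lam v := by
  rw [phiRight_eq, Matrix.conjTranspose_nonsing_inv, phiLeft_conjTranspose]

theorem posDef_phiLeft {lam : ℝ} (hlam : 0 < lam) (v : Matrix (Fin n) (Fin d) ℂ) :
    (phiLeft lam v).PosDef :=
  (Matrix.PosDef.one.smul (by exact_mod_cast hlam)).add_posSemidef
    (Matrix.posSemidef_self_mul_conjTranspose v)

theorem posDef_phiRight {lam : ℝ} (hlam : 0 < lam) (v : Matrix (Fin n) (Fin d) ℂ) :
    (phiRight lam v).PosDef := by
  rw [phiRight_eq]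
  exact (posDef_phiLeft hlam vᴴ).inv

theorem contDiffAt_phiRight {lam : ℝ} {v : Matrix (Fin n) (Fin d) ℂ}
    (hv : (phiRight lam v).PosDef) :
    ContDiffAt ℝ ∞ (phiRight lam : Matrix (Fin n) (Fin d) ℂ → _) v := by
  have h1 : ContDiffAt ℝ ∞ (fun w : Matrix (Fin n) (Fin d) ℂ => phiLeft lam wᴴ) v :=
    (contDiff_phiLeft lam).contDiffAt.comp v ((conjTransposeL n d).contDiffAt_comp contDiffAt_id)
  rw [phiRight_eq] at hv
  have h2 := (contDiffAt_matrix_inv (Matrix.posDef_inv_iff.1 hv).isUnit).comp v h1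
  exact h2.congr_of_eventuallyEq (Filter.Eventually.of_forall fun w => phiRight_eq lam w)

theorem hasDerivAt_phiLeft_line (lam : ℝ) (v w : Matrix (Fin n) (Fin d) ℂ) :
    HasDerivAt (fun t : ℝ => phiLeft lam (v + t • w)) (w * vᴴ + v * wᴴ) 0 := by
  have hline : HasDerivAt (fun t : ℝ => v + t • w) w 0 := (hasFDerivAt_id v).line w
  have h := hline.matMul ((conjTransposeL n d).hasDerivAt_comp hline)
  rw [zero_smul, add_zero] at h
  exact h.const_add ((lam : ℂ) • (1 : Matrix (Fin n) (Fin n) ℂ))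

theorem fderiv_bMat_mem_bLie {m : ℕ} {J : Matrix (Fin n) (Fin d) ℂ → BGroup m}
    {v : Matrix (Fin n) (Fin d) ℂ} (hJ : DifferentiableAt ℝ (fun w => bMat (J w)) v)
    (w : Matrix (Fin n) (Fin d) ℂ) : fderiv ℝ (fun w => bMat (J w)) v w ∈ bLie m := by
  rw [← kProj_eq_zero_iff]
  have h1 : HasDerivAt (fun t : ℝ => kProj (bMat (J (v + t • w)))) _ 0 :=
    (kProjL m).hasDerivAt_comp (hJ.hasFDerivAt.line w)
  have h2 : (fun t : ℝ => kProj (bMat (J (v + t • w)))) = fun _ => 0 :=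
    funext fun t => kProj_eq_zero_iff.2 (bMat_mem_bLie _)
  rw [h2] at h1
  exact h1.unique (hasDerivAt_const 0 0)

/-- The right-invariant form defined by `X`, in terms of the hermitian part of the left
logarithmic derivative `b⁻¹ δ`. -/
theorem imTr_mul_bMat_inv {m : ℕ} (X : Matrix (Fin m) (Fin m) ℂ) (b : BGroup m)
    {δ : Matrix (Fin m) (Fin m) ℂ} (hδ : δ ∈ bLie m) :
    imTr X (δ * bMat b⁻¹) = 1 / 2 * (kProj (bMat b⁻¹ * X * bMat b) *
      (bMat b⁻¹ * δ + (bMat b⁻¹ * δ)ᴴ)).trace.im := by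
  have h1 : imTr X (δ * bMat b⁻¹) = (bMat b⁻¹ * X * bMat b * (bMat b⁻¹ * δ)).trace.im := by
    rw [imTr, Matrix.mul_assoc _ (bMat b), ← Matrix.mul_assoc (bMat b), bMat_mul_inv, one_mul,
      Matrix.mul_assoc, Matrix.trace_mul_comm (bMat b⁻¹), Matrix.mul_assoc]
  have hζ := mul_mem_bLie (bMat_mem_bLie b⁻¹) hδ
  rw [h1]
  generalize bMat b⁻¹ * X * bMat b = G
  generalize bMat b⁻¹ * δ = ζ at *
  have h2 := im_trace_of_mem_bLie (mul_mem_bLie (sub_kProj_mem G) hζ)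
  have h3 := im_trace_conjTranspose (kProj G * ζᴴ)
  rw [Matrix.conjTranspose_mul, Matrix.conjTranspose_conjTranspose, mem_uLie.1 (kProj_mem G),
    Matrix.mul_neg, Matrix.trace_neg, Complex.neg_im, Matrix.trace_mul_comm] at h3
  rw [sub_mul, Matrix.trace_sub, Complex.sub_im] at h2
  rw [mul_add, Matrix.trace_add, Complex.add_im]
  linarith

/-- Projecting to `u(m)` after conjugating by `b` and before conjugating back recovers `X`. -/
theorem kProj_conj_kProj_conj {m : ℕ} {X : Matrix (Fin m) (Fin m) ℂ} (hX : X ∈ uLie m)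
    (b : BGroup m) : kProj (bMat b * kProj (bMat b⁻¹ * X * bMat b) * bMat b⁻¹) = X := by
  refine kProj_unique hX ?_
  have h : bMat b * (bMat b⁻¹ * X * bMat b) * bMat b⁻¹ = X := by
    rw [← Matrix.mul_assoc, ← Matrix.mul_assoc, bMat_mul_inv, one_mul, Matrix.mul_assoc,
      bMat_mul_inv, mul_one]
  have h1 := mul_mem_bLie (mul_mem_bLie (bMat_mem_bLie b)
    (sub_kProj_mem (bMat b⁻¹ * X * bMat b))) (bMat_mem_bLie b⁻¹)
  rw [mul_sub, sub_mul, h] at h1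
  simpa using neg_mem h1

/-- The two summands of `w v† + v w†` contribute equally when paired with an element of `u(n)`. -/
theorem im_trace_mul_hermitian {N : Matrix (Fin n) (Fin n) ℂ} (hN : N ∈ uLie n)
    (v w : Matrix (Fin n) (Fin d) ℂ) :
    (N * (w * vᴴ + v * wᴴ)).trace.im = 2 * (N * (w * vᴴ)).trace.im := by
  have h := im_trace_conjTranspose (N * (v * wᴴ))
  rw [Matrix.conjTranspose_mul, Matrix.conjTranspose_mul, Matrix.conjTranspose_conjTranspose,
    mem_uLie.1 hN, Matrix.mul_neg, Matrix.trace_neg, Complex.neg_im, Matrix.trace_mul_comm] at h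
  rw [mul_add, Matrix.trace_add, Complex.add_im]
  linarith

theorem bMat_conjTranspose_mul_inv {m : ℕ} (b : BGroup m) : (bMat b)ᴴ * (bMat b⁻¹)ᴴ = 1 := by
  rw [← Matrix.conjTranspose_mul, bMat_inv_mul, Matrix.conjTranspose_one]

theorem hasDerivAt_bOf_comp_line {m : ℕ}
    {h : Matrix (Fin n) (Fin d) ℂ → Matrix (Fin m) (Fin m) ℂ} {v : Matrix (Fin n) (Fin d) ℂ}
    (hs : ContDiffAt ℝ ∞ h v) (hh : ∀ w, (h w)ᴴ = h w) (hv : (h v).PosDef)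
    (w : Matrix (Fin n) (Fin d) ℂ) :
    fderiv ℝ (fun w => bMat (bOf (h w))) v w ∈ bLie m ∧
      HasDerivAt (fun t : ℝ => bMat (bOf (h (v + t • w))))
        (fderiv ℝ (fun w => bMat (bOf (h w))) v w) 0 ∧
      ∀ᶠ t : ℝ in nhds 0, (h (v + t • w)).PosDef := by
  obtain ⟨hJ, hev⟩ := contDiffAt_bOf_comp hs hh hv
  have hd : DifferentiableAt ℝ (fun w => bMat (bOf (h w))) v := hJ.differentiableAt (by simp)
  refine ⟨fderiv_bMat_mem_bLie hd w, hd.hasFDerivAt.line w, ?_⟩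
  have hc : Filter.Tendsto (fun t : ℝ => v + t • w) (nhds 0) (nhds v) := by
    have : Continuous fun t : ℝ => v + t • w := by fun_prop
    simpa using this.tendsto 0
  exact hc.eventually hev

/-- The pull-back along the momentum map for the left action, as a matrix. It is found by
differentiating `b b† = λ + v v†`. -/
theorem covMat_pullbackForm_left {lam : ℝ} {v : Matrix (Fin n) (Fin d) ℂ}
    (hv : (phiLeft lam v).PosDef) {X : Matrix (Fin n) (Fin n) ℂ} {b : BGroup n}
    (hb : b = bOf (phiLeft lam v)) :
    covMat (pullbackForm (fun v => bOf (phiLeft lam v)) X v) =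
      vᴴ * ((bMat b⁻¹)ᴴ * kProj (bMat b⁻¹ * X * bMat b) * bMat b⁻¹) := by
  refine covMat_unique fun w => ?_
  obtain ⟨hδ, hd, hev⟩ := hasDerivAt_bOf_comp_line (contDiff_phiLeft lam).contDiffAt
    (phiLeft_conjTranspose lam) hv w
  have hd' : HasDerivAt (fun t : ℝ => (bMat (bOf (phiLeft lam (v + t • w))))ᴴ) _ 0 :=
    (conjTransposeL n n).hasDerivAt_comp hd
  have h1 := (hd.matMul hd').congr_of_eventuallyEq (f₁ := fun t : ℝ => phiLeft lam (v + t • w))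
    (hev.mono fun t ht => (bOf_spec ht).symm)
  have h2 := h1.unique (hasDerivAt_phiLeft_line lam v w)
  simp only [zero_smul, add_zero] at h2
  change imTr X (fderiv ℝ (fun w => bMat (bOf (phiLeft lam w))) v w *
    bMat (bOf (phiLeft lam v))⁻¹) = _
  rw [← hb] at h2 ⊢
  generalize fderiv ℝ (fun w => bMat (bOf (phiLeft lam w))) v w = δ at hδ h2 ⊢
  change δ * (bMat b)ᴴ + bMat b * δᴴ = _ at h2
  have h3 : bMat b⁻¹ * δ + (bMat b⁻¹ * δ)ᴴ = bMat b⁻¹ * (w * vᴴ + v * wᴴ) * (bMat b⁻¹)ᴴ := by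
    rw [← h2, mul_add, add_mul, Matrix.mul_assoc, Matrix.mul_assoc, bMat_conjTranspose_mul_inv,
      mul_one, ← Matrix.mul_assoc, bMat_inv_mul, one_mul, Matrix.conjTranspose_mul]
  have hN : (bMat b⁻¹)ᴴ * kProj (bMat b⁻¹ * X * bMat b) * bMat b⁻¹ ∈ uLie n := by
    simpa using conj_mem_uLie (kProj_mem (bMat b⁻¹ * X * bMat b)) (bMat b⁻¹)ᴴ
  rw [imTr_mul_bMat_inv X b hδ, h3]
  have h4 := im_trace_mul_hermitian hN v w
  rw [← Matrix.mul_assoc, Matrix.trace_mul_comm, ← Matrix.mul_assoc, ← Matrix.mul_assoc, h4,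
    Matrix.mul_assoc vᴴ, Matrix.trace_mul_comm vᴴ, Matrix.mul_assoc _ w]
  ring

theorem bMat_conjTranspose_mul_phiLeft_mul {lam : ℝ} {v : Matrix (Fin n) (Fin d) ℂ}
    (hv : (phiRight lam v).PosDef) :
    (bMat (bOf (phiRight lam v)))ᴴ * phiLeft lam vᴴ * bMat (bOf (phiRight lam v)) = 1 := by
  have hv' := hv
  rw [phiRight_eq] at hv'
  rw [Matrix.mul_assoc, mul_eq_one_comm, Matrix.mul_assoc, bOf_spec hv, phiRight_eq]
  exact Matrix.mul_nonsing_inv _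
    ((Matrix.isUnit_iff_isUnit_det _).1 (Matrix.posDef_inv_iff.1 hv').isUnit)

theorem bMat_conjTranspose_mul_phiLeft {lam : ℝ} {v : Matrix (Fin n) (Fin d) ℂ}
    (hv : (phiRight lam v).PosDef) :
    (bMat (bOf (phiRight lam v)))ᴴ * phiLeft lam vᴴ = bMat (bOf (phiRight lam v))⁻¹ := by
  have h0 := bMat_conjTranspose_mul_phiLeft_mul hv
  generalize bOf (phiRight lam v) = b at h0 ⊢
  rw [← mul_one ((bMat b)ᴴ * phiLeft lam vᴴ), ← bMat_mul_inv b, ← Matrix.mul_assoc, h0, one_mul]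

theorem phiLeft_mul_bMat {lam : ℝ} {v : Matrix (Fin n) (Fin d) ℂ}
    (hv : (phiRight lam v).PosDef) :
    phiLeft lam vᴴ * bMat (bOf (phiRight lam v)) = (bMat (bOf (phiRight lam v))⁻¹)ᴴ := by
  rw [← bMat_conjTranspose_mul_phiLeft hv, Matrix.conjTranspose_mul,
    Matrix.conjTranspose_conjTranspose, phiLeft_conjTranspose]

/-- The pull-back along the momentum map for the right action, as a matrix. It is found by
differentiating `b† (λ + v† v) b = 1`. -/
theorem covMat_pullbackForm_right {lam : ℝ} {v : Matrix (Fin n) (Fin d) ℂ}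
    (hv : (phiRight lam v).PosDef) {X : Matrix (Fin d) (Fin d) ℂ} {b : BGroup d}
    (hb : b = bOf (phiRight lam v)) :
    covMat (pullbackForm (fun v => bOf (phiRight lam v)) X v) =
      -(bMat b * kProj (bMat b⁻¹ * X * bMat b) * (bMat b)ᴴ * vᴴ) := by
  refine covMat_unique fun w => ?_
  obtain ⟨hδ, hd, hev⟩ := hasDerivAt_bOf_comp_line (contDiffAt_phiRight hv)
    (phiRight_conjTranspose lam) hv w
  have hd' : HasDerivAt (fun t : ℝ => (bMat (bOf (phiRight lam (v + t • w))))ᴴ) _ 0 :=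
    (conjTransposeL d d).hasDerivAt_comp hd
  have hΦ : HasDerivAt (fun t : ℝ => phiLeft lam (v + t • w)ᴴ) (wᴴ * v + vᴴ * w) 0 := by
    simpa using hasDerivAt_phiLeft_line lam vᴴ wᴴ
  have h1 := ((hd'.matMul hΦ).matMul hd).congr_of_eventuallyEq (f₁ := fun t : ℝ => 1)
    (hev.mono fun t ht => (bMat_conjTranspose_mul_phiLeft_mul ht).symm)
  have h2 := h1.unique (hasDerivAt_const (0 : ℝ) (1 : Matrix (Fin d) (Fin d) ℂ))
  have h5 := bMat_conjTranspose_mul_phiLeft hv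
  have h6 := phiLeft_mul_bMat hv
  simp only [zero_smul, add_zero] at h2
  change imTr X (fderiv ℝ (fun w => bMat (bOf (phiRight lam w))) v w *
    bMat (bOf (phiRight lam v))⁻¹) = _
  rw [← hb] at h2 h5 h6 ⊢
  generalize fderiv ℝ (fun w => bMat (bOf (phiRight lam w))) v w = δ at hδ h2 ⊢
  change (δᴴ * phiLeft lam vᴴ + (bMat b)ᴴ * (wᴴ * v + vᴴ * w)) * bMat b
    + (bMat b)ᴴ * phiLeft lam vᴴ * δ = 0 at h2
  have h3 : bMat b⁻¹ * δ + (bMat b⁻¹ * δ)ᴴ = -((bMat b)ᴴ * (wᴴ * v + vᴴ * w) * bMat b) := by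
    rw [h5, add_mul, Matrix.mul_assoc δᴴ, h6] at h2
    rw [Matrix.conjTranspose_mul, eq_neg_iff_add_eq_zero, ← h2]
    abel
  have hN := conj_mem_uLie (kProj_mem (bMat b⁻¹ * X * bMat b)) (bMat b)
  rw [imTr_mul_bMat_inv X b hδ, h3]
  have h4 := im_trace_mul_hermitian hN wᴴ vᴴ
  rw [Matrix.conjTranspose_conjTranspose, Matrix.conjTranspose_conjTranspose,
    add_comm (vᴴ * w)] at h4
  rw [mul_neg, Matrix.trace_neg, Complex.neg_im, ← Matrix.mul_assoc, Matrix.trace_mul_comm,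
    ← Matrix.mul_assoc, ← Matrix.mul_assoc, h4, Matrix.neg_mul, Matrix.trace_neg, Complex.neg_im,
    Matrix.mul_assoc _ vᴴ]
  ring

theorem infAct_actLeft (X : uLie n) (v : Matrix (Fin n) (Fin d) ℂ) :
    infAct actLeft X v = X.1 * v := by
  have h := (hasDerivAt_expU X).matMul (hasDerivAt_const (0 : ℝ) v)
  rw [Matrix.mul_zero, add_zero] at h
  exact h.deriv

theorem infAct_actRight (X : uLie d) (v : Matrix (Fin n) (Fin d) ℂ) :
    infAct actRight X v = -(v * X.1) := by
  have h := (hasDerivAt_const (0 : ℝ) v).matMul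
    ((conjTransposeL d d).hasDerivAt_comp (hasDerivAt_expU X))
  refine h.deriv.trans ?_
  change 0 * _ + v * (X.1)ᴴ = _
  rw [mem_uLie.1 X.2, Matrix.zero_mul, zero_add, Matrix.mul_neg]

/-- The Hamiltonian vector at `v` of the pull-back along the momentum map of the left action. -/
theorem hamVec_left {lam : ℝ} {v : Matrix (Fin n) (Fin d) ℂ} {b : BGroup n}
    (hb : bMat b * (bMat b)ᴴ = phiLeft lam v) {X : Matrix (Fin n) (Fin n) ℂ} (hX : X ∈ uLie n) :
    hamVec 1 lam v (vᴴ * ((bMat b⁻¹)ᴴ * kProj (bMat b⁻¹ * X * bMat b) * bMat b⁻¹)) = X * v := by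
  have hN : (bMat b⁻¹)ᴴ * kProj (bMat b⁻¹ * X * bMat b) * bMat b⁻¹ ∈ uLie n := by
    simpa using conj_mem_uLie (kProj_mem (bMat b⁻¹ * X * bMat b)) (bMat b⁻¹)ᴴ
  have h1 : phiLeft lam v * ((bMat b⁻¹)ᴴ * kProj (bMat b⁻¹ * X * bMat b) * bMat b⁻¹) =
      bMat b * kProj (bMat b⁻¹ * X * bMat b) * bMat b⁻¹ := by
    rw [← hb, Matrix.mul_assoc, ← Matrix.mul_assoc (bMat b)ᴴ, ← Matrix.mul_assoc (bMat b)ᴴ,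
      bMat_conjTranspose_mul_inv, one_mul, ← Matrix.mul_assoc (bMat b)]
  have h2 := kProj_conj_kProj_conj hX b
  rw [← h1] at h2
  generalize (bMat b⁻¹)ᴴ * kProj (bMat b⁻¹ * X * bMat b) * bMat b⁻¹ = N at hN h1 h2 ⊢
  have h3 : phiLeft lam v * N = lam • N + v * (vᴴ * N) := by
    rw [phiLeft, add_mul, Matrix.smul_mul, one_mul, Matrix.mul_assoc]
    rfl
  have h4 : kProj (vᴴ * N * v) = vᴴ * N * v :=
    kProj_of_mem_uLie (by simpa using conj_mem_uLie hN vᴴ)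
  rw [h3, kProj_add, kProj_smul, kProj_of_mem_uLie hN] at h2
  have h5 : kProj (v * (vᴴ * N)) = X - lam • N := eq_sub_of_add_eq' h2
  simp only [hamVec, rMat, h4, h5]
  simp only [Matrix.conjTranspose_mul, Matrix.conjTranspose_conjTranspose,
    mem_uLie.1 hN, Matrix.sub_mul, Matrix.mul_sub, Matrix.smul_mul, Matrix.mul_smul,
    Matrix.mul_assoc, Matrix.neg_mul]
  module

/-- The Hamiltonian vector at `v` of the pull-back along the momentum map of the right action. -/
theorem hamVec_right {lam : ℝ} {v : Matrix (Fin n) (Fin d) ℂ} {b : BGroup d}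
    (hb : (bMat b)ᴴ * phiLeft lam vᴴ = bMat b⁻¹) {X : Matrix (Fin d) (Fin d) ℂ}
    (hX : X ∈ uLie d) :
    hamVec 1 lam v (-(bMat b * kProj (bMat b⁻¹ * X * bMat b) * (bMat b)ᴴ * vᴴ)) = -(v * X) := by
  have hN := conj_mem_uLie (kProj_mem (bMat b⁻¹ * X * bMat b)) (bMat b)
  have h1 : bMat b * kProj (bMat b⁻¹ * X * bMat b) * (bMat b)ᴴ * phiLeft lam vᴴ =
      bMat b * kProj (bMat b⁻¹ * X * bMat b) * bMat b⁻¹ := by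
    rw [Matrix.mul_assoc, hb]
  have h2 := kProj_conj_kProj_conj hX b
  rw [← h1] at h2
  generalize bMat b * kProj (bMat b⁻¹ * X * bMat b) * (bMat b)ᴴ = N at hN h1 h2 ⊢
  have h3 : N * phiLeft lam vᴴ = lam • N + N * vᴴ * v := by
    rw [phiLeft, mul_add, Matrix.mul_smul, mul_one, Matrix.conjTranspose_conjTranspose,
      Matrix.mul_assoc]
    rfl
  have h4 : kProj (v * (N * vᴴ)) = v * (N * vᴴ) :=
    kProj_of_mem_uLie (by rw [← Matrix.mul_assoc]; exact conj_mem_uLie hN v)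
  rw [h3, kProj_add, kProj_smul, kProj_of_mem_uLie hN] at h2
  have h5 : kProj (N * vᴴ * v) = X - lam • N := eq_sub_of_add_eq' h2
  rw [← neg_one_smul ℝ (N * vᴴ), hamVec_smul]
  simp only [hamVec, rMat, h4, h5]
  simp only [Matrix.conjTranspose_mul, Matrix.conjTranspose_conjTranspose,
    mem_uLie.1 hN, Matrix.sub_mul, Matrix.mul_sub, Matrix.smul_mul, Matrix.mul_smul,
    Matrix.mul_assoc, Matrix.mul_neg]
  module

end

theorem isMomentumMapOn_left (n d : ℕ) (lam : ℝ) :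
    IsMomentumMapOn lam actLeft {v : Matrix (Fin n) (Fin d) ℂ | (phiLeft lam v).PosDef}
      (fun v => bOf (phiLeft lam v)) where
  poissonLie := isPoissonLieBracket_bracketU n
  poisson := isPoissonBracket_bracketM lam
  poissonAction := isPoissonAction_actLeft n d lam
  isOpen := isOpen_iff_mem_nhds.2 fun _ hv =>
    (contDiffAt_bOf_comp (contDiff_phiLeft lam).contDiffAt (phiLeft_conjTranspose lam) hv).2
  smooth := fun _ hv => (contDiffAt_bOf_comp (contDiff_phiLeft lam).contDiffAt
    (phiLeft_conjTranspose lam) hv).1.contDiffWithinAt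
  momentum := fun X v hv α => by
    rw [poissonM_eq, covMat_pullbackForm_left hv rfl, hamVec_left (bOf_spec hv) X.2,
      infAct_actLeft, covMat_spec α]

theorem isMomentumMapOn_right (n d : ℕ) (lam : ℝ) :
    IsMomentumMapOn lam actRight {v : Matrix (Fin n) (Fin d) ℂ | (phiRight lam v).PosDef}
      (fun v => bOf (phiRight lam v)) where
  poissonLie := isPoissonLieBracket_bracketU d
  poisson := isPoissonBracket_bracketM lam
  poissonAction := isPoissonAction_actRight n d lam
  isOpen := isOpen_iff_mem_nhds.2 fun _ hv =>
    (contDiffAt_bOf_comp (contDiffAt_phiRight hv) (phiRight_conjTranspose lam) hv).2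
  smooth := fun _ hv => (contDiffAt_bOf_comp (contDiffAt_phiRight hv)
    (phiRight_conjTranspose lam) hv).1.contDiffWithinAt
  momentum := fun X v hv α => by
    rw [poissonM_eq, covMat_pullbackForm_right hv rfl, hamVec_right
      (bMat_conjTranspose_mul_phiLeft hv) X.2, infAct_actRight, covMat_spec α]

theorem proposition4 (n d : ℕ) (lam : ℝ) (hlam : lam ≠ 0) :
    -- the identification of `B` with positive definite matrices
    (∀ m : ℕ, Set.BijOn (fun b : BGroup m => bMat b * (bMat b)ᴴ) Set.univ
      {Λ : Matrix (Fin m) (Fin m) ℂ | Λ.PosDef}) ∧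
    -- for positive `lam` the two maps take positive definite values everywhere
    (0 < lam → ∀ v : Matrix (Fin n) (Fin d) ℂ,
      (phiLeft lam v).PosDef ∧ (phiRight lam v).PosDef) ∧
    -- the two maps are momentum maps where their values are positive definite
    IsMomentumMapOn lam actLeft
      {v : Matrix (Fin n) (Fin d) ℂ | (phiLeft lam v).PosDef} (fun v => bOf (phiLeft lam v)) ∧
    IsMomentumMapOn lam actRight
      {v : Matrix (Fin n) (Fin d) ℂ | (phiRight lam v).PosDef} (fun v => bOf (phiRight lam v)) :=
  ⟨bijOn_bMat_mul, fun h v => ⟨posDef_phiLeft h v, posDef_phiRight h v⟩,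
    isMomentumMapOn_left n d lam, isMomentumMapOn_right n d lam⟩
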